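/- Let $n,r,m$ be integers with $n,r\ge 0$, $m\ge 1$, let $\alpha>0$, let $\mathcal A:\mathbb S^n\to\mathbb R^{m-1}$ be linear on the space $\mathbb S^n$ of real symmetric $n\times n$ matrices, let $b\in\mathbb R^{m-1}$, let $e\in\mathbb R^n$ be the all-ones vector and $J=I-ee^\top/n$. Write $\langle A,B\rangle=\mathrm{Tr}(A^\top B)$, and let $\mathcal A^*$ be the adjoint of $\mathcal A$. For $C\in\mathbb S^n$ consider $$\text{SDP1: }\ \min\{\langle C,X\rangle:\ X\in\Omega^1_\alpha,\ \mathcal A(X)=b,\ Xe=0,\ \langle X,ee^\top\rangle=0\},\qquad \Omega^1_\alpha=\{X\in\mathbb S^n:\ \alpha I\succeq X\succeq 0\},$$ $$\text{SDPLR1: }\ \min\{\tfrac12\langle C,RR^\top\rangle:\ R\in\Omega^2_\alpha,\ \mathcal A(RR^\top)=b,\ R^\top e=0\},\qquad \Omega^2_\alpha=\{R\in\mathbb R^{n\times r}:\ \|R\|_2\le\sqrt\alpha\},$$ where $\|\cdot\|_2$ is the spectral norm. Let $\Phi\subset\mathbb R^{n\times r}$ be the feasible set of SDPLR1, and for $R\in\mathbb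 R^{n\times r}$ put $$g_R(H)=\big(\tfrac12\mathcal A(RH^\top+HR^\top),\,H^\top e\big)\in\mathbb R^{m-1}\times\mathbb R^r,\qquad g_R^*(y,z)=\mathcal A^*(y)R+ez^\top .$$ For a convex set $S$ and $X\in S$ let $\mathcal N_S(X)=\{Z:\langle Z,Y-X\rangle\le 0\ \forall Y\in S\}$ be the normal cone, taken in the ambient space $\mathbb S^n$ for $S=\Omega_\alpha^1$ and $\mathbb R^{n\times r}$ for $S=\Omega_\alpha^2$. *Regular point.* $R\in\Phi$ is regular (constraint nondegenerate) if $g_R(\Gamma_R)=\mathbb R^{m-1}\times\mathbb R^r$, where $\Gamma_R=\{H\in\mathbb R^{n\times r}:U_1^\top HV_1+V_1^\top H^\top U_1=0\}$ and $U_1,V_1$ are matrices whose columns are the left and the right singular vectors of $R$ for the singular value $\sqrt\alpha$ in a singular value decomposition of $R$ (if $\sqrt\alpha$ is not a singular value, $\Gamma_R=\mathbb R^{n\times r}$). *Second order stationary point.* $R\in\Phi$ is a second order stationary point of SDPLR1 if $\langle CR,h\rangle\ge 0$ for every $h$ with $\mathrm{dist}(R+th,\Phi)=o(t)$ as $t\downarrow0$,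 and, for every such $h$ with $\langle CR,h\rangle=0$, $\langle CR,w\rangle+\langle Ch,h\rangle\ge0$ for every $w$ with $\mathrm{dist}(R+th+\tfrac{t^2}{2}w,\Phi)=o(t^2)$ as $t\downarrow0$. *KKT system.* $(y,z,\Theta)\in\mathbb R^{m-1}\times\mathbb R^r\times\mathbb R^{n\times r}$ satisfies the KKT system of SDPLR1 at $R$ if $R\in\Phi$, $\Theta\in\mathcal N_{\Omega^2_\alpha}(R)$ and $(C-\mathcal A^*(y))R-ez^\top=-\Theta$. **Theorem.** Suppose that the maximum $\beta:=\max\{\mathrm{Tr}(X):X\in\mathbb S^n,\ \mathcal A(X)=b,\ Xe=0,\ X\succeq0\}$ exists (and is finite) and that $r\ge\lceil\beta/\alpha\rceil+\sqrt{2m}$. Then there is a Lebesgue-null set $N\subset\mathbb S^n$ such that for every $C\in\mathbb S^n\setminus N$ and every regular second order stationary point $R$ of SDPLR1: 1. $R$ is a global minimizer of SDPLR1, and $RR^\top$ is a global optimal solution of SDP1. 2. The linear map $g_Rg_R^*$ is invertible, the KKT system at $R$ has a solution $(y,z,\Theta)$, and every solution $(y,z,\Theta)$ satisfies $g_R^*(y,z)=CR+\Theta$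 and $$(y,z)=(g_Rg_R^*)^{-1}g_R(CR+\Theta).$$ 3. For every solution $(y,z,\Theta)$ of the KKT system at $R$, $y$ is a dual variable for SDP1 at $RR^\top$, in the sense that $J(C-\mathcal A^*(y))J\in-\mathcal N_{\Omega^1_\alpha}(RR^\top)$. -/

import Mathlib

open Matrix Filter Topology Asymptotics MeasureTheory

open scoped Matrix.Norms.Frobenius

noncomputable section

/-- The space `𝕊ⁿ` of real symmetric `n × n` matrices. -/
def SymMat (n : ℕ) : Submodule ℝ (Matrix (Fin n) (Fin n) ℝ) where
  carrier := {X | X.IsSymm}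
  add_mem' := fun hX hY => Matrix.IsSymm.add hX hY
  zero_mem' := Matrix.isSymm_zero
  smul_mem' := fun c _ hX => Matrix.IsSymm.smul hX c

/-- The symmetric matrix whose `(i, j)` and `(j, i)` entries are both `c s(i, j)`. This identifies
`ℝ^{n(n+1)/2}` (functions on unordered pairs of indices) with `𝕊ⁿ`. -/
def symOfEntries {n : ℕ} (c : Sym2 (Fin n) → ℝ) : SymMat n :=
  ⟨Matrix.of fun i j => c s(i, j), by
    ext i j
    simp [Matrix.transpose_apply, Sym2.eq_swap]⟩

/-- A set of symmetric matrices is Lebesgue-null if it is null in the coordinates given by the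
`n(n+1)/2` independent entries. -/
def SymNull {n : ℕ} (N : Set (SymMat n)) : Prop :=
  volume (symOfEntries ⁻¹' N) = 0

/-- The trace inner product `⟨A, B⟩ = Tr(Aᵀ B)`. -/
def frob {p q : ℕ} (A B : Matrix (Fin p) (Fin q) ℝ) : ℝ := (Aᵀ * B).trace

/-- The all-ones vector `e`. -/
def ones (n : ℕ) : Fin n → ℝ := fun _ => 1

/-- `J = I - e eᵀ / n`. -/
def centering (n : ℕ) : Matrix (Fin n) (Fin n) ℝ :=
  1 - (n : ℝ)⁻¹ • Matrix.vecMulVec (ones n) (ones n)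

/-- `R Rᵀ` as a symmetric matrix. -/
def gramSym {n r : ℕ} (R : Matrix (Fin n) (Fin r) ℝ) : SymMat n :=
  ⟨R * Rᵀ, by
    change (R * Rᵀ)ᵀ = R * Rᵀ
    simp [Matrix.transpose_mul]⟩

/-- `(R Hᵀ + H Rᵀ) / 2` as a symmetric matrix, linear in `H`. -/
def symProd {n r : ℕ} (R : Matrix (Fin n) (Fin r) ℝ) :
    Matrix (Fin n) (Fin r) ℝ →ₗ[ℝ] SymMat n where
  toFun H := ⟨(1 / 2 : ℝ) • (R * Hᵀ + H * Rᵀ), by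
    change ((1 / 2 : ℝ) • (R * Hᵀ + H * Rᵀ))ᵀ = (1 / 2 : ℝ) • (R * Hᵀ + H * Rᵀ)
    simp [Matrix.transpose_mul, add_comm]⟩
  map_add' H K := by
    apply Subtype.ext
    simp only [Matrix.transpose_add, Matrix.mul_add, Matrix.add_mul, Submodule.coe_add,
      smul_add]
    abel
  map_smul' c H := by
    apply Subtype.ext
    simp only [Matrix.transpose_smul, Matrix.mul_smul, Matrix.smul_mul, Submodule.coe_smul,
      RingHom.id_apply, smul_add, smul_comm c]

/-- The symmetric matrix `(E_ij + E_ji) / 2`. -/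
def symUnit {n : ℕ} (i j : Fin n) : SymMat n :=
  ⟨(1 / 2 : ℝ) • (Matrix.single i j 1 + Matrix.single j i 1), by
    change ((1 / 2 : ℝ) • (Matrix.single i j (1 : ℝ) + Matrix.single j i 1))ᵀ = _
    simp [Matrix.transpose_add, add_comm]⟩

section Constraint

variable {n k r : ℕ}

/-- The adjoint `𝒜* : ℝᵏ → 𝕊ⁿ` with respect to the trace inner product; see `frob_opAdjoint`. -/
def opAdjoint (A : SymMat n →ₗ[ℝ] (Fin k → ℝ)) : (Fin k → ℝ) →ₗ[ℝ] SymMat n where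
  toFun y := ⟨Matrix.of fun i j => y ⬝ᵥ A (symUnit i j), by
    have h : ∀ i j : Fin n, symUnit i j = symUnit j i := fun i j => by
      simp [symUnit, add_comm]
    ext i j
    simp [Matrix.transpose_apply, h i j]⟩
  map_add' y z := by
    apply Subtype.ext
    ext i j
    simp [add_dotProduct]
  map_smul' c y := by
    apply Subtype.ext
    ext i j
    simp [smul_dotProduct]

/-- `⟨𝒜*(y), X⟩ = ⟨y, 𝒜(X)⟩`. -/
theorem frob_opAdjoint (A : SymMat n →ₗ[ℝ] (Fin k → ℝ)) (y : Fin k → ℝ) (X : SymMat n) :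
    frob (opAdjoint A y : Matrix (Fin n) (Fin n) ℝ) X = y ⬝ᵥ A X := by
  have hX : X = ∑ i, ∑ j, (X : Matrix (Fin n) (Fin n) ℝ) i j • symUnit i j := by
    apply Subtype.ext
    have hs : ∀ a b, (X : Matrix (Fin n) (Fin n) ℝ) a b
        = (X : Matrix (Fin n) (Fin n) ℝ) b a := fun a b => Matrix.IsSymm.apply X.2 b a
    ext a b
    simp only [symUnit, AddSubmonoidClass.coe_finsetSum, Submodule.coe_smul, Matrix.sum_apply,
      Matrix.smul_apply, Matrix.add_apply, Matrix.single_apply, smul_eq_mul, mul_add,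
      Finset.sum_add_distrib, ite_and, mul_ite, mul_one, mul_zero]
    simp [Finset.sum_ite_eq']
    rw [hs b a]; ring
  conv_rhs => rw [hX]
  simp only [map_sum, map_smul, dotProduct_sum, dotProduct_smul, smul_eq_mul]
  simp only [frob, opAdjoint, Matrix.trace, Matrix.diag, Matrix.mul_apply, Matrix.transpose_apply]
  rw [Finset.sum_comm]
  refine Finset.sum_congr rfl fun i _ => Finset.sum_congr rfl fun j _ => ?_
  simp [mul_comm]

/-- `g_R(H) = (𝒜(R Hᵀ + H Rᵀ) / 2, Hᵀ e)`, the differential at `R` of the equality constraints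
`((𝒜(R Rᵀ) - b) / 2, Rᵀ e)`. -/
def gMap (A : SymMat n →ₗ[ℝ] (Fin k → ℝ)) (R : Matrix (Fin n) (Fin r) ℝ) :
    Matrix (Fin n) (Fin r) ℝ →ₗ[ℝ] (Fin k → ℝ) × (Fin r → ℝ) where
  toFun H := (A (symProd R H), Hᵀ *ᵥ ones n)
  map_add' H K := by simp [Matrix.add_mulVec]
  map_smul' c H := by simp [Matrix.smul_mulVec]

/-- `g_R*(y, z) = 𝒜*(y) R + e zᵀ`; see `frob_gAdjoint`. -/
def gAdjoint (A : SymMat n →ₗ[ℝ] (Fin k → ℝ)) (R : Matrix (Fin n) (Fin r) ℝ) :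
    (Fin k → ℝ) × (Fin r → ℝ) →ₗ[ℝ] Matrix (Fin n) (Fin r) ℝ where
  toFun p := (opAdjoint A p.1 : Matrix (Fin n) (Fin n) ℝ) * R + Matrix.vecMulVec (ones n) p.2
  map_add' p q := by
    simp only [Prod.fst_add, Prod.snd_add, map_add, Submodule.coe_add, Matrix.add_mul,
      Matrix.vecMulVec_add]
    abel
  map_smul' c p := by
    simp [Matrix.vecMulVec_smul]

/-- `⟨g_R*(y, z), H⟩ = ⟨(y, z), g_R(H)⟩`. -/
theorem frob_gAdjoint (A : SymMat n →ₗ[ℝ] (Fin k → ℝ)) (R H : Matrix (Fin n) (Fin r) ℝ)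
    (p : (Fin k → ℝ) × (Fin r → ℝ)) :
    frob (gAdjoint A R p) H = p.1 ⬝ᵥ (gMap A R H).1 + p.2 ⬝ᵥ (gMap A R H).2 := by
  have hS : (opAdjoint A p.1 : Matrix (Fin n) (Fin n) ℝ)ᵀ = opAdjoint A p.1 :=
    (opAdjoint A p.1).2
  simp only [gMap, gAdjoint, LinearMap.coe_mk, AddHom.coe_mk]
  rw [← frob_opAdjoint]
  set S := ((opAdjoint A p.1 : SymMat n) : Matrix (Fin n) (Fin n) ℝ)
  have h1 : frob S (symProd R H : Matrix (Fin n) (Fin n) ℝ) = frob (S * R) H := by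
    have e1 : (S * (R * Hᵀ)).trace = (Rᵀ * S * H).trace := by
      rw [← Matrix.trace_transpose (S * (R * Hᵀ))]
      simp only [Matrix.transpose_mul, Matrix.transpose_transpose, hS]
      rw [Matrix.mul_assoc, Matrix.trace_mul_comm, Matrix.mul_assoc]
    have e2 : (S * (H * Rᵀ)).trace = (Rᵀ * S * H).trace := by
      rw [← Matrix.mul_assoc, Matrix.trace_mul_comm, Matrix.mul_assoc]
    simp only [frob, symProd, LinearMap.coe_mk, AddHom.coe_mk, hS, Matrix.mul_smul,
      Matrix.mul_add, Matrix.trace_smul, Matrix.trace_add, e1, e2, Matrix.transpose_mul,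
      smul_eq_mul]
    ring
  rw [h1]
  simp only [frob, Matrix.transpose_add, Matrix.add_mul, Matrix.trace_add]
  congr 1
  simp only [Matrix.trace, Matrix.diag, Matrix.mul_apply, Matrix.transpose_apply,
    Matrix.vecMulVec_apply, dotProduct, Matrix.mulVec, ones, Finset.mul_sum]
  refine Finset.sum_congr rfl fun i _ => Finset.sum_congr rfl fun j _ => ?_
  ring

end Constraint

section Sets

variable {n r : ℕ}

/-- The spectral norm `‖R‖₂`, i.e. the operator norm between Euclidean spaces. -/
def specNorm (R : Matrix (Fin n) (Fin r) ℝ) : ℝ :=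
  ‖LinearMap.toContinuousLinearMap (Matrix.toEuclideanLin R)‖

/-- `Ω_α¹ = {X ∈ 𝕊ⁿ : α I ⪰ X ⪰ 0}`. -/
def OmegaOne (n : ℕ) (α : ℝ) : Set (SymMat n) :=
  {X | (X : Matrix (Fin n) (Fin n) ℝ).PosSemidef ∧
    (α • (1 : Matrix (Fin n) (Fin n) ℝ) - X).PosSemidef}

/-- `Ω_α² = {R ∈ ℝ^{n×r} : ‖R‖₂ ≤ √α}`. -/
def OmegaTwo (n r : ℕ) (α : ℝ) : Set (Matrix (Fin n) (Fin r) ℝ) :=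
  {R | specNorm R ≤ √α}

/-- The normal cone of a (convex) set `S` of `p × q` matrices at a point `X` of `S`. -/
def normalCone {p q : ℕ} (S : Set (Matrix (Fin p) (Fin q) ℝ)) (X : Matrix (Fin p) (Fin q) ℝ) :
    Set (Matrix (Fin p) (Fin q) ℝ) :=
  {Z | ∀ Y ∈ S, frob Z (Y - X) ≤ 0}

/-- The normal cone of a (convex) set `S` of symmetric matrices at a point `X` of `S`, taken in
the space of symmetric matrices. -/
def symNormalCone (S : Set (SymMat n)) (X : SymMat n) : Set (SymMat n) :=
  {Z | ∀ Y ∈ S, frob (Z : Matrix (Fin n) (Fin n) ℝ) (Y - X : SymMat n) ≤ 0}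

/-- `J S J` as a symmetric matrix. -/
def centered (S : SymMat n) : SymMat n :=
  ⟨centering n * S * centering n, by
    have hS : (S : Matrix (Fin n) (Fin n) ℝ)ᵀ = S := S.2
    have hJ : (centering n)ᵀ = centering n := by
      simp [centering, Matrix.transpose_vecMulVec]
    change (centering n * (S : Matrix (Fin n) (Fin n) ℝ) * centering n)ᵀ = _
    rw [Matrix.transpose_mul, Matrix.transpose_mul, hS, hJ, Matrix.mul_assoc]⟩

end Sets

section Tangent

variable {E : Type*} [NormedAddCommGroup E] [NormedSpace ℝ E]

/-- Inner tangent cone: `dist(x + t h, S) = o(t)` as `t ↓ 0`. -/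
def innerTangentCone (S : Set E) (x : E) : Set E :=
  {h | (fun t : ℝ => Metric.infDist (x + t • h) S) =o[𝓝[>] 0] fun t : ℝ => t}

/-- Inner second order tangent set: `dist(x + t h + t² w / 2, S) = o(t²)` as `t ↓ 0`. -/
def innerSecondTangentSet (S : Set E) (x h : E) : Set E :=
  {w | (fun t : ℝ => Metric.infDist (x + t • h + (t ^ 2 / 2) • w) S) =o[𝓝[>] 0]
    fun t : ℝ => t ^ 2}

end Tangent

section Problems

variable {n k r : ℕ}

/-- Feasible set of SDP1. -/
def sdpFeasible (A : SymMat n →ₗ[ℝ] (Fin k → ℝ)) (b : Fin k → ℝ) (α : ℝ) : Set (SymMat n) :=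
  {X | A X = b ∧ (X : Matrix (Fin n) (Fin n) ℝ) *ᵥ ones n = 0 ∧
    frob (X : Matrix (Fin n) (Fin n) ℝ) (Matrix.vecMulVec (ones n) (ones n)) = 0 ∧
    X ∈ OmegaOne n α}

/-- `X` is a global optimal solution of SDP1: minimize `⟨C, X⟩` over the feasible set. -/
def IsSDPSolution (C : SymMat n) (A : SymMat n →ₗ[ℝ] (Fin k → ℝ)) (b : Fin k → ℝ) (α : ℝ)
    (X : SymMat n) : Prop :=
  X ∈ sdpFeasible A b α ∧
    IsMinOn (fun Y : SymMat n => frob (C : Matrix (Fin n) (Fin n) ℝ) Y) (sdpFeasible A b α) X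

/-- Feasible set of the factorized problem SDPLR1. -/
def lrFeasible (r : ℕ) (A : SymMat n →ₗ[ℝ] (Fin k → ℝ)) (b : Fin k → ℝ) (α : ℝ) :
    Set (Matrix (Fin n) (Fin r) ℝ) :=
  {R | A (gramSym R) = b ∧ Rᵀ *ᵥ ones n = 0 ∧ R ∈ OmegaTwo n r α}

/-- `R` is a global minimizer of SDPLR1: minimize `⟨C, R Rᵀ⟩ / 2` over the feasible set. -/
def IsLRSolution (C : SymMat n) (A : SymMat n →ₗ[ℝ] (Fin k → ℝ)) (b : Fin k → ℝ) (α : ℝ)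
    (R : Matrix (Fin n) (Fin r) ℝ) : Prop :=
  R ∈ lrFeasible r A b α ∧
    IsMinOn (fun Q : Matrix (Fin n) (Fin r) ℝ =>
      (1 / 2 : ℝ) * frob (C : Matrix (Fin n) (Fin n) ℝ) (gramSym Q : Matrix (Fin n) (Fin n) ℝ))
      (lrFeasible r A b α) R

/-- `R` is a second order stationary point of SDPLR1. The objective `f(R) = ⟨C, R Rᵀ⟩ / 2` has
`f'(R)[h] = ⟨C R, h⟩` and `f''(R)[h, h] = ⟨C h, h⟩`. The first order condition says `f'(R)[h] ≥ 0`
for every tangent direction `h` of the feasible set, the second order condition says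
`f'(R)[w] + f''(R)[h, h] ≥ 0` for every such `h` with `f'(R)[h] = 0` and every `w` in the
second order tangent set in the direction `h`. -/
def IsSecondOrderStationary (C : SymMat n) (A : SymMat n →ₗ[ℝ] (Fin k → ℝ)) (b : Fin k → ℝ)
    (α : ℝ) (R : Matrix (Fin n) (Fin r) ℝ) : Prop :=
  R ∈ lrFeasible r A b α ∧
  (∀ h ∈ innerTangentCone (lrFeasible r A b α) R,
    0 ≤ frob ((C : Matrix (Fin n) (Fin n) ℝ) * R) h) ∧
  (∀ h ∈ innerTangentCone (lrFeasible r A b α) R,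
    frob ((C : Matrix (Fin n) (Fin n) ℝ) * R) h = 0 →
    ∀ w ∈ innerSecondTangentSet (lrFeasible r A b α) R h,
      0 ≤ frob ((C : Matrix (Fin n) (Fin n) ℝ) * R) w
        + frob ((C : Matrix (Fin n) (Fin n) ℝ) * h) h)

/-- `(u, v)` is a (not necessarily normalized) pair of left and right singular vectors of `R` for
the singular value `√α`. For an SVD of `R` whose blocks for `√α` are `U₁` and `V₁`, these pairs
are exactly the `(U₁ a, V₁ a)`. -/
def IsTopSingularPair (α : ℝ) (R : Matrix (Fin n) (Fin r) ℝ) (u : Fin n → ℝ) (v : Fin r → ℝ) :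
    Prop :=
  R *ᵥ v = √α • u ∧ Rᵀ *ᵥ u = √α • v

/-- `Γ_R = {H : U₁ᵀ H V₁ + V₁ᵀ Hᵀ U₁ = 0}`, written without choosing `U₁` and `V₁`; see
`mem_GammaSet_iff`. -/
def GammaSet (α : ℝ) (R : Matrix (Fin n) (Fin r) ℝ) : Set (Matrix (Fin n) (Fin r) ℝ) :=
  {H | ∀ u v u' v', IsTopSingularPair α R u v → IsTopSingularPair α R u' v' →
    u ⬝ᵥ (H *ᵥ v') + u' ⬝ᵥ (H *ᵥ v) = 0}

theorem mem_GammaSet_iff {α : ℝ} {R H : Matrix (Fin n) (Fin r) ℝ} {l : ℕ}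
    (U : Matrix (Fin n) (Fin l) ℝ) (V : Matrix (Fin r) (Fin l) ℝ)
    (hUV : ∀ u v, IsTopSingularPair α R u v ↔ ∃ a, u = U *ᵥ a ∧ v = V *ᵥ a) :
    H ∈ GammaSet α R ↔ Uᵀ * H * V + Vᵀ * Hᵀ * U = 0 := by
  have key : ∀ a a' : Fin l → ℝ,
      (U *ᵥ a) ⬝ᵥ (H *ᵥ (V *ᵥ a')) + (U *ᵥ a') ⬝ᵥ (H *ᵥ (V *ᵥ a))
        = a ⬝ᵥ ((Uᵀ * H * V + Vᵀ * Hᵀ * U) *ᵥ a') := by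
    intro a a'
    have e2 : (U *ᵥ a') ⬝ᵥ (H *ᵥ (V *ᵥ a)) = a ⬝ᵥ ((Vᵀ * Hᵀ * U) *ᵥ a') := by
      rw [dotProduct_comm, Matrix.mulVec_mulVec, dotProduct_comm, Matrix.dotProduct_mulVec,
        dotProduct_comm, ← Matrix.mulVec_transpose, Matrix.mulVec_mulVec,
        Matrix.transpose_mul]
    have e1 : (U *ᵥ a) ⬝ᵥ (H *ᵥ (V *ᵥ a')) = a ⬝ᵥ ((Uᵀ * H * V) *ᵥ a') := by
      rw [dotProduct_comm, Matrix.dotProduct_mulVec, dotProduct_comm,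
        ← Matrix.mulVec_transpose, Matrix.mulVec_mulVec, Matrix.mulVec_mulVec, Matrix.mul_assoc]
    rw [e1, e2, Matrix.add_mulVec, dotProduct_add]
  constructor
  · intro hH
    ext i j
    have h := hH _ _ _ _ ((hUV _ _).2 ⟨Pi.single i 1, rfl, rfl⟩)
      ((hUV _ _).2 ⟨Pi.single j 1, rfl, rfl⟩)
    rw [key] at h
    simpa using h
  · intro h0 u v u' v' h h'
    obtain ⟨a, rfl, rfl⟩ := (hUV _ _).1 h
    obtain ⟨a', rfl, rfl⟩ := (hUV _ _).1 h'
    rw [key, h0]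
    simp

/-- `R` is a regular (constraint nondegenerate) point of SDPLR1: it is feasible and
`g_R(Γ_R)` is the whole space. -/
def IsRegularPoint (A : SymMat n →ₗ[ℝ] (Fin k → ℝ)) (b : Fin k → ℝ) (α : ℝ)
    (R : Matrix (Fin n) (Fin r) ℝ) : Prop :=
  R ∈ lrFeasible r A b α ∧ gMap A R '' GammaSet α R = Set.univ

/-- The first order KKT system of SDPLR1 at `R`:
`R` is feasible, `Θ ∈ 𝒩_{Ω_α²}(R)` and `(C - 𝒜*(y)) R - e zᵀ = -Θ`. -/
def IsKKT (C : SymMat n) (A : SymMat n →ₗ[ℝ] (Fin k → ℝ)) (b : Fin k → ℝ) (α : ℝ)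
    (R : Matrix (Fin n) (Fin r) ℝ) (y : Fin k → ℝ) (z : Fin r → ℝ)
    (Θ : Matrix (Fin n) (Fin r) ℝ) : Prop :=
  R ∈ lrFeasible r A b α ∧ Θ ∈ normalCone (OmegaTwo n r α) R ∧
    ((C - opAdjoint A y : SymMat n) : Matrix (Fin n) (Fin n) ℝ) * R
      - Matrix.vecMulVec (ones n) z = -Θ

end Problems

end

/-!
Let `R` be a regular second order stationary point and let `P` be the projection onto the top right
singular space of `R` (singular value `√α`).

*Normal cone.* A normal vector `Θ` of the spectral norm ball at `R` is `R Q` with `Q ⪰ 0` supported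
on that singular space (`exists_eq_mul_of_mem_normalCone`); in particular it is orthogonal to `Γ_R`.

*Tangents.* Nondegeneracy `g_R(Γ_R) = ℝᵏ × ℝʳ` therefore implies Robinson's constraint qualification,
by separation (`exists_cover_of_isRegularPoint`), and this gives metric regularity of the equality
constraints on the ball, by a Newton iteration inside the ball (`exists_solution_near`). A curve
which satisfies all constraints up to `o(t)` or `o(t²)` can thus be corrected to a feasible one.
Directions in `Γ_R` violate the ball constraint to second order only, which supplies enough first
order tangents (`mem_innerTangentCone`) to produce multipliers (`exists_isKKT`), and enough second
order tangents (`mem_innerSecondTangentSet`).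

*Rank deficiency.* With `Θ = R Q`, the equation `(C - 𝒜*(y)) R = e zᵀ - Θ` says that `C - 𝒜*(y)` maps
`R (ker P)` into the span of `e`. If `R` were injective, this would be a subspace of `e^⊥` of
dimension `d ≥ r - β / α ≥ √(2m)`. Since `d (d + 1) / 2 > m - 1`, a dimension count shows that such
`C` form a null set: they are covered by finitely many smooth images of spaces of dimension less
than `n (n + 1) / 2` for each `d` (`symNull_exceptionalCosts`).

*Optimality.* Hence `R v = 0` for some `v ≠ 0`. Along the curves with velocity `u vᵀ` the second order
condition reads `uᵀ (C - 𝒜*(y)) u ≥ 0` for all `u` orthogonal to `e` and to the top left singular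
space (`quadForm_nonneg_of_isSecondOrderStationary`). Together with the KKT system this is the dual
certificate `J (C - 𝒜*(y)) J ∈ -𝒩(R Rᵀ)` (`neg_centered_mem_symNormalCone`), and weak duality finishes
the proof.
-/

noncomputable section

/-! ### Quadratic forms, spectral decomposition and the spectral norm ball -/

theorem mulVec_dotProduct_mulVec {l m n : Type*} [Fintype l] [Fintype m] [Fintype n]
    (M : Matrix l m ℝ) (N : Matrix l n ℝ) (x : m → ℝ) (y : n → ℝ) :
    (M *ᵥ x) ⬝ᵥ (N *ᵥ y) = x ⬝ᵥ ((Mᵀ * N) *ᵥ y) := by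
  rw [← mulVec_mulVec, dotProduct_mulVec x, vecMul_transpose]

theorem posSemidef_iff_real {n : Type*} [Fintype n] {M : Matrix n n ℝ} :
    M.PosSemidef ↔ Mᵀ = M ∧ ∀ x, 0 ≤ x ⬝ᵥ (M *ᵥ x) := by
  rw [posSemidef_iff_dotProduct_mulVec]
  simp [IsHermitian, conjTranspose_eq_transpose_of_trivial]

theorem dotProduct_self_nonneg_real {n : Type*} [Fintype n] (x : n → ℝ) : 0 ≤ x ⬝ᵥ x :=
  Finset.sum_nonneg fun i _ => mul_self_nonneg (x i)

theorem dotProduct_sq_le {n : Type*} [Fintype n] (x y : n → ℝ) :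
    (x ⬝ᵥ y) ^ 2 ≤ (x ⬝ᵥ x) * (y ⬝ᵥ y) := by
  have := Finset.sum_mul_sq_le_sq_mul_sq Finset.univ x y
  simpa [dotProduct, sq] using this

theorem exists_orthogonal_diagonalization {n : Type*} [Fintype n] [DecidableEq n]
    {M : Matrix n n ℝ} (hM : Mᵀ = M) :
    ∃ (V : Matrix n n ℝ) (l : n → ℝ), Vᵀ * V = 1 ∧ V * Vᵀ = 1 ∧ M * V = V * diagonal l := by
  have hH : M.IsHermitian := by
    rw [IsHermitian, conjTranspose_eq_transpose_of_trivial, hM]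
  have h1 : (hH.eigenvectorUnitary : Matrix n n ℝ)ᵀ * hH.eigenvectorUnitary = 1 :=
    Unitary.coe_star_mul_self hH.eigenvectorUnitary
  refine ⟨hH.eigenvectorUnitary, hH.eigenvalues, h1, mul_eq_one_comm.1 h1, ?_⟩
  ext i j
  have := congrFun (hH.mulVec_eigenvectorBasis j) i
  rw [mul_diagonal]
  simpa [Matrix.mul_apply, mulVec, dotProduct, mul_comm] using this

theorem specNorm_le_iff {n r : ℕ} {α : ℝ} (hα : 0 ≤ α) (R : Matrix (Fin n) (Fin r) ℝ) :
    specNorm R ≤ √α ↔ ∀ x, (R *ᵥ x) ⬝ᵥ (R *ᵥ x) ≤ α * (x ⬝ᵥ x) := by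
  have hn : ∀ {k : ℕ} (y : EuclideanSpace ℝ (Fin k)), ‖y‖ ^ 2 = y.ofLp ⬝ᵥ y.ofLp := by
    intro k y
    rw [EuclideanSpace.real_norm_sq_eq, dotProduct]
    exact Finset.sum_congr rfl fun i _ => sq (y i)
  rw [specNorm, ContinuousLinearMap.opNorm_le_iff (Real.sqrt_nonneg α)]
  have key : ∀ y : EuclideanSpace ℝ (Fin r),
      (‖LinearMap.toContinuousLinearMap (Matrix.toEuclideanLin R) y‖ ≤ √α * ‖y‖ ↔
        (R *ᵥ y.ofLp) ⬝ᵥ (R *ᵥ y.ofLp) ≤ α * (y.ofLp ⬝ᵥ y.ofLp)) := by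
    intro y
    rw [← sq_le_sq₀ (norm_nonneg _) (by positivity), mul_pow, Real.sq_sqrt hα, hn, hn]
    rfl
  constructor
  · intro h x
    exact (key (WithLp.toLp 2 x)).1 (h _)
  · intro h y
    exact (key y).2 (h _)

theorem mem_OmegaTwo_iff {n r : ℕ} {α : ℝ} (hα : 0 ≤ α) {R : Matrix (Fin n) (Fin r) ℝ} :
    R ∈ OmegaTwo n r α ↔ ∀ x, (R *ᵥ x) ⬝ᵥ (R *ᵥ x) ≤ α * (x ⬝ᵥ x) :=
  specNorm_le_iff hα R

theorem mulVec_transpose_le_of_mem_OmegaTwo {n r : ℕ} {α : ℝ} (hα : 0 ≤ α)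
    {R : Matrix (Fin n) (Fin r) ℝ} (hR : R ∈ OmegaTwo n r α) (u : Fin n → ℝ) :
    (Rᵀ *ᵥ u) ⬝ᵥ (Rᵀ *ᵥ u) ≤ α * (u ⬝ᵥ u) := by
  set w := Rᵀ *ᵥ u with hw
  have h1 : w ⬝ᵥ w = u ⬝ᵥ (R *ᵥ w) := by
    rw [dotProduct_mulVec u, ← mulVec_transpose, ← hw]
  have h2 := (mem_OmegaTwo_iff hα).1 hR w
  have h3 := dotProduct_sq_le u (R *ᵥ w)
  rw [← h1] at h3
  have hu := dotProduct_self_nonneg_real u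
  rcases (dotProduct_self_nonneg_real w).eq_or_lt with h0 | h0
  · rw [← h0]; positivity
  · have h4 : (w ⬝ᵥ w) * (w ⬝ᵥ w) ≤ (α * (u ⬝ᵥ u)) * (w ⬝ᵥ w) := by
      nlinarith [mul_le_mul_of_nonneg_left h2 hu]
    exact le_of_mul_le_mul_right h4 h0

theorem posSemidef_smul_one_sub_transpose_mul {n r : ℕ} {α : ℝ} (hα : 0 ≤ α)
    {R : Matrix (Fin n) (Fin r) ℝ} (hR : R ∈ OmegaTwo n r α) :
    (α • (1 : Matrix (Fin r) (Fin r) ℝ) - Rᵀ * R).PosSemidef := by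
  refine posSemidef_iff_real.2 ⟨by simp [transpose_mul], fun x => ?_⟩
  have := (mem_OmegaTwo_iff hα).1 hR x
  rw [mulVec_dotProduct_mulVec] at this
  simpa [sub_mulVec, smul_mulVec, dotProduct_sub] using this

theorem gramSym_mem_OmegaOne {n r : ℕ} {α : ℝ} (hα : 0 ≤ α)
    {R : Matrix (Fin n) (Fin r) ℝ} (hR : R ∈ OmegaTwo n r α) :
    gramSym R ∈ OmegaOne n α := by
  constructor
  · simpa [gramSym, conjTranspose_eq_transpose_of_trivial] using
      posSemidef_self_mul_conjTranspose R
  · refine posSemidef_iff_real.2 ⟨by simp [gramSym, transpose_mul], fun x => ?_⟩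
    have := mulVec_transpose_le_of_mem_OmegaTwo hα hR x
    rw [mulVec_dotProduct_mulVec, transpose_transpose] at this
    simpa [gramSym, sub_mulVec, smul_mulVec, dotProduct_sub] using this

/-- A vector on which `R` attains the spectral norm bound is a right singular vector. -/
theorem transpose_mul_mulVec_of_norm_eq {n r : ℕ} {α : ℝ} (hα : 0 ≤ α)
    {R : Matrix (Fin n) (Fin r) ℝ} (hR : R ∈ OmegaTwo n r α) {x : Fin r → ℝ}
    (hx : (R *ᵥ x) ⬝ᵥ (R *ᵥ x) = α * (x ⬝ᵥ x)) : (Rᵀ * R) *ᵥ x = α • x := by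
  have h := (posSemidef_smul_one_sub_transpose_mul hα hR).dotProduct_mulVec_zero_iff x
  rw [mulVec_dotProduct_mulVec] at hx
  simp only [star_trivial, sub_mulVec, smul_mulVec, one_mulVec, dotProduct_sub,
    dotProduct_smul, hx, smul_eq_mul, sub_self, true_iff] at h
  exact (sub_eq_zero.1 h).symm

/-- `P` is the orthogonal projection onto the eigenspace of `RᵀR` for the eigenvalue `α`, and `R`
is bounded by `√(α - δ)` on the kernel of `P`. -/
structure IsTopProjection {n r : ℕ} (α : ℝ) (R : Matrix (Fin n) (Fin r) ℝ)
    (P : Matrix (Fin r) (Fin r) ℝ) (δ : ℝ) : Prop where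
  symm : Pᵀ = P
  idem : P * P = P
  eig : Rᵀ * R * P = α • P
  pos : 0 < δ
  gap : ∀ x, P *ᵥ x = 0 → (R *ᵥ x) ⬝ᵥ (R *ᵥ x) ≤ (α - δ) * (x ⬝ᵥ x)

/-- The projection onto the top right singular space exists, and the columns of `W` form an
orthonormal basis of its kernel. Each of the `r - d` top right singular vectors contributes `α` to
the trace of `RᵀR`. -/
theorem exists_isTopProjection {n r : ℕ} {α : ℝ} (hα : 0 ≤ α)
    {R : Matrix (Fin n) (Fin r) ℝ} (hR : R ∈ OmegaTwo n r α) :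
    ∃ (P : Matrix (Fin r) (Fin r) ℝ) (d : ℕ) (W : Matrix (Fin r) (Fin d) ℝ) (δ : ℝ),
      IsTopProjection α R P δ ∧ P * W = 0 ∧ Wᵀ * W = 1 ∧
      ((r : ℝ) - d) * α ≤ (Rᵀ * R).trace := by
  classical
  obtain ⟨V, l, h1, h2, h3⟩ :=
    exists_orthogonal_diagonalization (M := Rᵀ * R) (by simp [transpose_mul])
  have hquad : ∀ z : Fin r → ℝ,
      (R *ᵥ (V *ᵥ z)) ⬝ᵥ (R *ᵥ (V *ᵥ z)) = ∑ i, l i * z i ^ 2 := by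
    intro z
    rw [mulVec_dotProduct_mulVec, mulVec_mulVec, h3, mulVec_dotProduct_mulVec, ← Matrix.mul_assoc,
      h1, Matrix.one_mul]
    simp only [dotProduct, mulVec_diagonal]
    exact Finset.sum_congr rfl fun i _ => by ring
  have hnorm : ∀ z : Fin r → ℝ, (V *ᵥ z) ⬝ᵥ (V *ᵥ z) = ∑ i, z i ^ 2 := by
    intro z
    rw [mulVec_dotProduct_mulVec, h1, one_mulVec]
    exact Finset.sum_congr rfl fun i _ => by ring
  have hl : ∀ i, l i ≤ α ∧ 0 ≤ l i := by
    intro i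
    have ha := hquad (Pi.single i 1)
    have hb := hnorm (Pi.single i 1)
    have hc := (mem_OmegaTwo_iff hα).1 hR (V *ᵥ Pi.single i 1)
    have hd := dotProduct_self_nonneg_real (R *ᵥ (V *ᵥ Pi.single i 1))
    rw [ha] at hc hd
    rw [hb] at hc
    simp [Pi.single_apply, ite_pow] at hc hd
    exact ⟨hc, hd⟩
  obtain ⟨δ, hδ, hδ0⟩ : ∃ δ : ℝ, (∀ i, l i ≠ α → l i ≤ α - δ) ∧ 0 < δ := by
    have : ∀ᶠ δ : ℝ in 𝓝[>] 0, ∀ i, l i ≠ α → l i ≤ α - δ := by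
      rw [eventually_all]
      intro i
      by_cases hi : l i = α
      · simp [hi]
      · have hlt : 0 < α - l i := sub_pos.2 (lt_of_le_of_ne (hl i).1 hi)
        filter_upwards [nhdsWithin_le_nhds (Iio_mem_nhds hlt)] with δ hδ _
        have : δ < α - l i := hδ
        linarith
    exact (this.and self_mem_nhdsWithin).exists
  set χ : Fin r → ℝ := fun i => if l i = α then 1 else 0 with hχ
  let e : Fin (Fintype.card {i // l i ≠ α}) ≃ {i // l i ≠ α} := (Fintype.equivFin _).symm
  let ι : Fin (Fintype.card {i // l i ≠ α}) → Fin r := fun j => (e j).1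
  have hι : Function.Injective ι := Subtype.val_injective.comp e.injective
  have hPV : V * diagonal χ * Vᵀ * V = V * diagonal χ := by
    rw [Matrix.mul_assoc, h1, Matrix.mul_one]
  refine ⟨V * diagonal χ * Vᵀ, _, V.submatrix id ι, δ, ⟨?_, ?_, ?_, hδ0, ?_⟩, ?_, ?_, ?_⟩
  · simp [transpose_mul, Matrix.mul_assoc]
  · rw [← Matrix.mul_assoc, ← Matrix.mul_assoc, hPV, Matrix.mul_assoc V, diagonal_mul_diagonal]
    congr 3
    funext i
    simp [hχ]
  · rw [← Matrix.mul_assoc, ← Matrix.mul_assoc, h3, Matrix.mul_assoc V, diagonal_mul_diagonal,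
      ← Matrix.smul_mul, ← Matrix.mul_smul, ← diagonal_smul]
    congr 3
    funext i
    by_cases hi : l i = α <;> simp [hχ, hi]
  · intro x hx
    obtain ⟨z, rfl⟩ : ∃ z, x = V *ᵥ z := ⟨Vᵀ *ᵥ x, by rw [mulVec_mulVec, h2, one_mulVec]⟩
    rw [mulVec_mulVec, hPV] at hx
    have hz : ∀ i, l i = α → z i = 0 := by
      intro i hi
      have h5 : Vᵀ *ᵥ ((V * diagonal χ) *ᵥ z) = 0 := by rw [hx, mulVec_zero]
      rw [mulVec_mulVec, ← Matrix.mul_assoc, h1, Matrix.one_mul] at h5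
      simpa [mulVec_diagonal, hχ, hi] using congrFun h5 i
    rw [hquad, hnorm, Finset.mul_sum]
    refine Finset.sum_le_sum fun i _ => ?_
    by_cases hi : l i = α
    · simp [hz i hi]
    · exact mul_le_mul_of_nonneg_right (hδ i hi) (sq_nonneg _)
  · have : V * diagonal χ * Vᵀ * V.submatrix id ι
        = (V * diagonal χ * Vᵀ * V).submatrix id ι := by
      rw [submatrix_mul _ _ id id ι Function.bijective_id]; simp
    rw [this, hPV]
    ext i j
    have : l (ι j) ≠ α := (e j).2
    simp [mul_diagonal, hχ, this]
  · have : (V.submatrix id ι)ᵀ * V.submatrix id ι = (Vᵀ * V).submatrix ι ι := by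
      rw [submatrix_mul _ _ ι id ι Function.bijective_id, transpose_submatrix]
    rw [this, h1, submatrix_one _ hι]
  · have ht : (Rᵀ * R).trace = ∑ i, l i := by
      have : Rᵀ * R = V * diagonal l * Vᵀ := by
        rw [← h3, Matrix.mul_assoc _ V, h2, Matrix.mul_one]
      rw [this, trace_mul_comm, ← Matrix.mul_assoc, h1, Matrix.one_mul, trace_diagonal]
    have hc : (r : ℝ) - (Fintype.card {i // l i ≠ α} : ℕ) = ∑ i, χ i := by
      have := Fintype.card_subtype_compl (fun i => l i = α)
      have h4 : Fintype.card {i // l i = α} ≤ r := by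
        simpa using Fintype.card_subtype_le (fun i => l i = α)
      rw [this, Fintype.card_fin, Nat.cast_sub h4, Fintype.card_subtype]
      simp [hχ]
    rw [ht, hc, Finset.sum_mul]
    refine Finset.sum_le_sum fun i _ => ?_
    by_cases hi : l i = α <;> simp [hχ, hi, (hl i).2]

/-! ### The normal cone of the spectral norm ball -/

theorem frob_eq_sum {p q : ℕ} (A B : Matrix (Fin p) (Fin q) ℝ) :
    frob A B = ∑ i, ∑ j, A i j * B i j := by
  simp only [frob, trace, diag, Matrix.mul_apply, transpose_apply]
  exact Finset.sum_comm

/-- A normal vector `Θ` of the spectral norm ball at `R` factors as `Θ = R Q` with `Q` positive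
semidefinite and supported on the top right singular space of `R`. It holds since
`⟨Θ, R⟩ ≥ √α ‖Θ‖_*` forces equality in Cauchy-Schwarz for each singular pair of `Θ`. -/
theorem exists_eq_mul_of_mem_normalCone {n r : ℕ} {α : ℝ} (hα : 0 < α)
    {R Θ : Matrix (Fin n) (Fin r) ℝ} (hR : R ∈ OmegaTwo n r α)
    (hΘ : Θ ∈ normalCone (OmegaTwo n r α) R) :
    ∃ Q : Matrix (Fin r) (Fin r) ℝ, Q.PosSemidef ∧ Θ = R * Q ∧ Rᵀ * R * Q = α • Q := by
  classical
  obtain ⟨V, l, h1, h2, h3⟩ :=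
    exists_orthogonal_diagonalization (M := Θᵀ * Θ) (by simp [transpose_mul])
  set a := √α with ha
  have haa : a * a = α := Real.mul_self_sqrt hα.le
  have ha0 : 0 < a := Real.sqrt_pos.2 hα
  let v : Fin r → Fin r → ℝ := fun i => V *ᵥ Pi.single i 1
  have hquad : ∀ z : Fin r → ℝ,
      (Θ *ᵥ (V *ᵥ z)) ⬝ᵥ (Θ *ᵥ (V *ᵥ z)) = ∑ i, l i * z i ^ 2 := by
    intro z
    rw [mulVec_dotProduct_mulVec, mulVec_mulVec, h3, mulVec_dotProduct_mulVec, ← Matrix.mul_assoc,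
      h1, Matrix.one_mul]
    simp only [dotProduct, mulVec_diagonal]
    exact Finset.sum_congr rfl fun i _ => by ring
  have hvv : ∀ i, v i ⬝ᵥ v i = 1 := by
    intro i
    simp only [v]
    rw [mulVec_dotProduct_mulVec, h1, one_mulVec]; simp
  have hvl : ∀ i, (Θ *ᵥ v i) ⬝ᵥ (Θ *ᵥ v i) = l i := by
    intro i
    have := hquad (Pi.single i 1)
    simp only [v]
    simpa [Pi.single_apply, ite_pow] using this
  have hl : ∀ i, 0 ≤ l i := fun i => hvl i ▸ dotProduct_self_nonneg_real _
  set s : Fin r → ℝ := fun i => √(l i) with hs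
  have hss : ∀ i, s i * s i = l i := fun i => Real.mul_self_sqrt (hl i)
  -- the partial isometry of the polar decomposition of `Θ`, scaled to the boundary of the ball;
  -- `(s i)⁻¹ = 0` where `s i = 0`
  set Y := a • (Θ * (V * diagonal (fun i => (s i)⁻¹) * Vᵀ)) with hY
  have hYmem : Y ∈ OmegaTwo n r α := by
    rw [mem_OmegaTwo_iff hα.le]
    intro x
    have e1 : Y *ᵥ x = a • (Θ *ᵥ (V *ᵥ (diagonal (fun i => (s i)⁻¹) *ᵥ (Vᵀ *ᵥ x)))) := by
      simp [hY, smul_mulVec, mulVec_mulVec, Matrix.mul_assoc]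
    have e2 : x ⬝ᵥ x = ∑ i, (Vᵀ *ᵥ x) i ^ 2 := by
      have : (Vᵀ *ᵥ x) ⬝ᵥ (Vᵀ *ᵥ x) = x ⬝ᵥ x := by
        rw [mulVec_dotProduct_mulVec, transpose_transpose, h2, one_mulVec]
      rw [← this]
      exact Finset.sum_congr rfl fun i _ => by ring
    rw [e1, smul_dotProduct, dotProduct_smul, hquad, e2, smul_eq_mul, smul_eq_mul, ← mul_assoc,
      haa]
    refine mul_le_mul_of_nonneg_left (Finset.sum_le_sum fun i _ => ?_) hα.le
    rw [mulVec_diagonal, mul_pow, ← hss i]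
    by_cases h0 : s i = 0
    · simp [h0, sq_nonneg]
    · apply le_of_eq; field_simp
  have htr : ∀ Z : Matrix (Fin n) (Fin r) ℝ,
      frob Θ Z = ∑ i, (Θ *ᵥ v i) ⬝ᵥ (Z *ᵥ v i) := by
    intro Z
    have : (Vᵀ * (Θᵀ * Z) * V).trace = (Θᵀ * Z).trace := by
      rw [trace_mul_comm, ← Matrix.mul_assoc, h2, Matrix.one_mul]
    rw [frob, ← this, trace]
    refine Finset.sum_congr rfl fun i _ => ?_
    simp only [v]
    rw [mulVec_dotProduct_mulVec, mulVec_dotProduct_mulVec, mulVec_mulVec]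
    simp
  have hYv : ∀ i, (Θ *ᵥ v i) ⬝ᵥ (Y *ᵥ v i) = a * s i := by
    intro i
    have : Y *ᵥ v i = (a * (s i)⁻¹) • (Θ *ᵥ v i) := by
      simp only [v, hY]
      rw [smul_mulVec, mulVec_mulVec, Matrix.mul_assoc, Matrix.mul_assoc _ Vᵀ, h1,
        Matrix.mul_one, ← mulVec_mulVec, ← mulVec_mulVec, diagonal_mulVec_single, mul_one]
      have : (Pi.single i (s i)⁻¹ : Fin r → ℝ) = (s i)⁻¹ • Pi.single i 1 := by
        rw [← Pi.single_smul]; simp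
      rw [this, mulVec_smul, mulVec_smul, smul_smul]
    rw [this, dotProduct_smul, hvl, smul_eq_mul, ← hss i]
    by_cases h0 : s i = 0
    · simp [h0]
    · field_simp
  have hle : ∀ i, (Θ *ᵥ v i) ⬝ᵥ (R *ᵥ v i) ≤ a * s i := by
    intro i
    have c1 := dotProduct_sq_le (Θ *ᵥ v i) (R *ᵥ v i)
    have c2 := (mem_OmegaTwo_iff hα.le).1 hR (v i)
    rw [hvl] at c1
    rw [hvv] at c2
    refine abs_le_of_sq_le_sq' ?_ (mul_nonneg ha0.le (Real.sqrt_nonneg _)) |>.2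
    calc _ ≤ _ := c1
      _ ≤ l i * (α * 1) := mul_le_mul_of_nonneg_left c2 (hl i)
      _ = (a * s i) ^ 2 := by rw [← hss, ← haa]; ring
  have hsum : ∑ i, a * s i ≤ ∑ i, (Θ *ᵥ v i) ⬝ᵥ (R *ᵥ v i) := by
    have := hΘ Y hYmem
    rw [htr] at this
    simp only [sub_mulVec, dotProduct_sub, hYv, Finset.sum_sub_distrib] at this
    linarith
  have heq : ∀ i, (Θ *ᵥ v i) ⬝ᵥ (R *ᵥ v i) = a * s i := by
    have := (Finset.sum_eq_sum_iff_of_le (s := Finset.univ) fun i _ => hle i).1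
      (le_antisymm (Finset.sum_le_sum fun i _ => hle i) hsum)
    exact fun i => this i (Finset.mem_univ i)
  have hRv : ∀ i, (R *ᵥ v i) ⬝ᵥ (R *ᵥ v i) ≤ α := fun i => by
    have := (mem_OmegaTwo_iff hα.le).1 hR (v i)
    rwa [hvv, mul_one] at this
  have hcol : ∀ i, a • (Θ *ᵥ v i) = s i • (R *ᵥ v i) := by
    intro i
    rw [← sub_eq_zero, ← dotProduct_self_eq_zero]
    refine le_antisymm ?_ (dotProduct_self_nonneg_real _)
    simp only [sub_dotProduct, dotProduct_sub, smul_dotProduct, dotProduct_smul, smul_eq_mul,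
      hvl, heq, dotProduct_comm (R *ᵥ v i) (Θ *ᵥ v i)]
    have := mul_le_mul_of_nonneg_left (hRv i) (hl i)
    rw [← hss i] at this ⊢
    rw [← haa] at this
    nlinarith
  have heig : ∀ i, s i ≠ 0 → (Rᵀ * R) *ᵥ v i = α • v i := by
    intro i hi
    apply transpose_mul_mulVec_of_norm_eq hα.le hR
    have := congrArg (fun w => w ⬝ᵥ w) (hcol i)
    simp only [smul_dotProduct, dotProduct_smul, smul_eq_mul, hvl] at this
    rw [hvv, mul_one]
    have h5 : 0 < s i := lt_of_le_of_ne (Real.sqrt_nonneg _) (Ne.symm hi)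
    have h6 : (s i * s i) * ((R *ᵥ v i) ⬝ᵥ (R *ᵥ v i)) = (s i * s i) * α := by
      rw [mul_assoc, ← this, ← mul_assoc, haa, hss, mul_comm]
    exact mul_left_cancel₀ (by positivity) h6
  have hext : ∀ {k : ℕ} (M N : Matrix (Fin k) (Fin r) ℝ), (∀ i, M *ᵥ v i = N *ᵥ v i) → M = N := by
    intro k M N h
    have : M * V = N * V := by
      ext i j
      have := congrFun (h j) i
      simp only [v, mulVec_mulVec] at this
      simpa using this
    calc M = M * V * Vᵀ := by rw [Matrix.mul_assoc, h2, Matrix.mul_one]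
      _ = N := by rw [this, Matrix.mul_assoc, h2, Matrix.mul_one]
  have hQv : ∀ i, (V * diagonal (fun i => s i / a) * Vᵀ) *ᵥ v i = (s i / a) • v i := by
    intro i
    simp only [v]
    rw [mulVec_mulVec, Matrix.mul_assoc, h1, Matrix.mul_one, ← mulVec_mulVec,
      diagonal_mulVec_single, mul_one]
    have : (Pi.single i (s i / a) : Fin r → ℝ) = (s i / a) • Pi.single i 1 := by
      rw [← Pi.single_smul]; simp
    rw [this, mulVec_smul]
  refine ⟨V * diagonal (fun i => s i / a) * Vᵀ, ?_, ?_, ?_⟩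
  · have : (diagonal (fun i => s i / a)).PosSemidef :=
      PosSemidef.diagonal fun i => div_nonneg (Real.sqrt_nonneg _) ha0.le
    simpa [conjTranspose_eq_transpose_of_trivial] using this.mul_mul_conjTranspose_same V
  · apply hext
    intro i
    rw [← mulVec_mulVec, hQv, mulVec_smul, div_eq_inv_mul, mul_smul, ← hcol, smul_smul,
      inv_mul_cancel₀ ha0.ne', one_smul]
  · apply hext
    intro i
    rw [← mulVec_mulVec, hQv, mulVec_smul, smul_mulVec, hQv]
    by_cases h0 : s i = 0
    · simp [h0]
    · rw [heig i h0, smul_comm]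

/-! ### Metric regularity of a smooth equation on a closed convex set -/

/-- One step of the modified Newton iteration that stays inside the convex set `S`: it moves
from `x` towards a point `y` of `S` at which the linearized equation is solved, and halves
the residual. -/
theorem exists_mem_halving {E G : Type*} [NormedAddCommGroup E] [NormedSpace ℝ E]
    [NormedAddCommGroup G] [NormedSpace ℝ G] {S : Set E} (hS : Convex ℝ S) {F : E → G}
    {F' : E →L[ℝ] G} {x₀ : E} {M ρ : ℝ} (hM : 0 < M) (hρ : 0 < ρ)
    (hbd : ∀ y ∈ S, ‖y - x₀‖ ≤ M)
    (hcover : ∀ w : G, ‖w‖ ≤ ρ → ∃ y ∈ S, F' (y - x₀) = w)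
    {ε c : ℝ} (hε : 0 < ε) (hc : c = 2 * M / ρ) (hcε : ε * c ≤ 1 / 4)
    {x : E} (hx : x ∈ S) (hxF : ‖F' (x - x₀)‖ ≤ ρ / 4) (hFx : ‖F x‖ ≤ ρ)
    (hstrict : ∀ x', ‖x' - x‖ ≤ c * ‖F x‖ → ‖F x' - F x - F' (x' - x)‖ ≤ ε * ‖x' - x‖) :
    ∃ x' ∈ S, ‖x' - x‖ ≤ c * ‖F x‖ ∧ ‖F x'‖ ≤ ‖F x‖ / 2 := by
  rcases eq_or_ne (F x) 0 with h0 | h0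
  · exact ⟨x, hx, by simp [h0], by simp [h0]⟩
  have hpos : 0 < ‖F x‖ := norm_pos_iff.2 h0
  set s := ‖F x‖ / ρ with hs
  have hs0 : 0 < s := div_pos hpos hρ
  have hs1 : s ≤ 1 := (div_le_one hρ).2 hFx
  obtain ⟨y, hy, hyw⟩ := hcover (-(s⁻¹ • F x)) (by
    rw [norm_neg, norm_smul, norm_inv, Real.norm_of_nonneg hs0.le, hs]
    apply le_of_eq; field_simp)
  have hx'x : x + s • (y - x) - x = s • (y - x) := by abel
  have hn : ‖x + s • (y - x) - x‖ ≤ c * ‖F x‖ := by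
    rw [hx'x, norm_smul, Real.norm_of_nonneg hs0.le]
    have : ‖y - x‖ ≤ 2 * M := by
      have := norm_sub_le (y - x₀) (x - x₀)
      rw [sub_sub_sub_cancel_right] at this
      linarith [hbd y hy, hbd x hx]
    calc s * ‖y - x‖ ≤ s * (2 * M) := by gcongr
      _ = c * ‖F x‖ := by rw [hs, hc]; field_simp
  refine ⟨x + s • (y - x), hS.add_smul_sub_mem hx hy ⟨hs0.le, hs1⟩, hn, ?_⟩
  have h1 := hstrict _ hn
  have h2 : F' (x + s • (y - x) - x) = -F x - s • F' (x - x₀) := by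
    rw [hx'x, map_smul, ← sub_sub_sub_cancel_right y x x₀, map_sub, hyw, smul_sub, smul_neg,
      smul_smul, mul_inv_cancel₀ hs0.ne', one_smul]
  rw [h2] at h1
  have h3 : F (x + s • (y - x)) = (F (x + s • (y - x)) - F x - (-F x - s • F' (x - x₀)))
      - s • F' (x - x₀) := by abel
  rw [h3]
  calc _ ≤ ‖F (x + s • (y - x)) - F x - (-F x - s • F' (x - x₀))‖ + ‖s • F' (x - x₀)‖ :=
        norm_sub_le _ _
    _ ≤ ε * (c * ‖F x‖) + s * (ρ / 4) := by
        rw [norm_smul, Real.norm_of_nonneg hs0.le]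
        gcongr
        exact h1.trans (by gcongr)
    _ ≤ 1 / 4 * ‖F x‖ + ‖F x‖ / 4 := by
        rw [← mul_assoc]
        gcongr
        rw [hs]; apply le_of_eq; field_simp
    _ = _ := by ring

/-- **Metric regularity** under Robinson's constraint qualification. If the linearization of the
equation `F = 0` at `x₀` maps the closed bounded convex set `S` onto a neighbourhood of `0`, then
near `x₀` the distance from a point of `S` to the solutions in `S` is `O(‖F x‖)`. -/
theorem exists_solution_near {E G : Type*} [NormedAddCommGroup E] [NormedSpace ℝ E]
    [CompleteSpace E] [NormedAddCommGroup G] [NormedSpace ℝ G] {S : Set E} (hS : Convex ℝ S)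
    (hSc : IsClosed S) {F : E → G} (hFc : Continuous F)
    {F' : E →L[ℝ] G} {x₀ : E} {M ρ : ℝ} (hM : 0 < M) (hρ : 0 < ρ)
    (hbd : ∀ y ∈ S, ‖y - x₀‖ ≤ M)
    (hcover : ∀ w : G, ‖w‖ ≤ ρ → ∃ y ∈ S, F' (y - x₀) = w)
    (hF' : HasStrictFDerivAt F F' x₀) (hF0 : F x₀ = 0) :
    ∃ c > 0, ∀ᶠ x in 𝓝 x₀, x ∈ S → ∃ z ∈ S, F z = 0 ∧ ‖z - x‖ ≤ c * ‖F x‖ := by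
  set c := 2 * M / ρ with hc
  have hc0 : 0 < c := by positivity
  obtain ⟨η, hη0, hη⟩ : ∃ η > 0, ∀ x x' : E, ‖x - x₀‖ < η → ‖x' - x₀‖ < η →
      ‖F x' - F x - F' (x' - x)‖ ≤ (1 / (4 * c)) * ‖x' - x‖ := by
    have := hF'.isLittleO.def (c := 1 / (4 * c)) (by positivity)
    rw [nhds_prod_eq, Metric.nhds_basis_ball.prod_self.eventually_iff] at this
    obtain ⟨η, hη, h⟩ := this
    refine ⟨η, hη, fun x x' hx hx' => ?_⟩
    exact h (x := (x', x)) ⟨by simpa [dist_eq_norm] using hx', by simpa [dist_eq_norm] using hx⟩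
  have ev1 : ∀ᶠ x in 𝓝 x₀, ‖F' (x - x₀)‖ < ρ / 4 := by
    have : Continuous fun x => ‖F' (x - x₀)‖ := by fun_prop
    exact this.continuousAt.eventually_lt continuousAt_const (by simpa using by positivity)
  obtain ⟨θ, hθ0, hθ⟩ := Metric.eventually_nhds_iff.1 ev1
  set κ := min η θ with hκ
  have hκ0 : 0 < κ := lt_min hη0 hθ0
  -- the residuals shrink like `2⁻ᵏ`, so all iterates stay within `2 c ‖F x‖` of the start
  have step : ∀ x ∈ S, ‖x - x₀‖ + c * ‖F x‖ < κ → ‖F x‖ ≤ ρ →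
      ∃ x' ∈ S, ‖x' - x‖ ≤ c * ‖F x‖ ∧ ‖F x'‖ ≤ ‖F x‖ / 2 := by
    intro x hx hxκ hFx
    have hxx : ‖x - x₀‖ < κ := lt_of_le_of_lt (by nlinarith [norm_nonneg (F x)]) hxκ
    refine exists_mem_halving hS hM hρ hbd hcover (ε := 1 / (4 * c)) (by positivity) hc
      (by apply le_of_eq; field_simp) hx
      (hθ (by rw [dist_eq_norm]; exact hxx.trans_le (min_le_right _ _))).le hFx ?_
    intro x' hx'
    apply hη x x' (hxx.trans_le (min_le_left _ _))
    refine lt_of_le_of_lt ?_ (hxκ.trans_le (min_le_left _ _))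
    have := norm_add_le (x' - x) (x - x₀)
    rw [sub_add_sub_cancel] at this
    linarith
  refine ⟨2 * c, by positivity, ?_⟩
  have ev2 : ∀ᶠ x in 𝓝 x₀, ‖x - x₀‖ + 2 * c * ‖F x‖ < κ := by
    have : Continuous fun x => ‖x - x₀‖ + 2 * c * ‖F x‖ := by fun_prop
    exact this.continuousAt.eventually_lt continuousAt_const (by simpa [hF0] using hκ0)
  have ev3 : ∀ᶠ x in 𝓝 x₀, ‖F x‖ < ρ :=
    hFc.norm.continuousAt.eventually_lt continuousAt_const (by simpa [hF0] using hρ)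
  filter_upwards [ev2, ev3] with x hxκ hxρ hxS
  let T := {u : E // u ∈ S ∧ ‖u - x₀‖ + 2 * c * ‖F u‖ < κ ∧ ‖F u‖ ≤ ρ}
  have next : ∀ u : T, ∃ u' : T, ‖u'.1 - u.1‖ ≤ c * ‖F u.1‖ ∧ ‖F u'.1‖ ≤ ‖F u.1‖ / 2 := by
    rintro ⟨u, hu, huκ, huρ⟩
    have hnn := norm_nonneg (F u)
    obtain ⟨x', hx', h1, h2⟩ := step u hu (by nlinarith) huρ
    refine ⟨⟨x', hx', ?_, by linarith⟩, h1, h2⟩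
    have := norm_add_le (x' - u) (u - x₀)
    rw [sub_add_sub_cancel] at this
    nlinarith
  choose nx hnx1 hnx2 using next
  let sq : ℕ → T := fun k => nx^[k] ⟨x, hxS, hxκ, hxρ.le⟩
  have hsq : ∀ k, sq (k + 1) = nx (sq k) := fun k => Function.iterate_succ_apply' _ _ _
  have hres : ∀ k, ‖F (sq k).1‖ ≤ ‖F x‖ / 2 ^ k := by
    intro k
    induction k with
    | zero => simp [sq]
    | succ k ih =>
      rw [hsq]
      refine (hnx2 _).trans ?_
      rw [pow_succ, ← div_div]
      linarith
  have hdist : ∀ k, dist ((sq k).1) ((sq (k + 1)).1) ≤ 2 * c * ‖F x‖ / 2 / 2 ^ k := by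
    intro k
    rw [dist_comm, dist_eq_norm, hsq]
    refine (hnx1 _).trans ?_
    calc _ ≤ c * (‖F x‖ / 2 ^ k) := by gcongr; exact hres k
      _ = _ := by ring
  obtain ⟨z, hz⟩ := cauchySeq_tendsto_of_complete (cauchySeq_of_le_geometric_two hdist)
  refine ⟨z, hSc.mem_of_tendsto hz (Eventually.of_forall fun k => (sq k).2.1), ?_, ?_⟩
  · have h1 : Tendsto (fun k => F (sq k).1) atTop (𝓝 (F z)) := (hFc.tendsto z).comp hz
    have h2 : Tendsto (fun k => F (sq k).1) atTop (𝓝 0) := by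
      apply squeeze_zero_norm hres
      have := (tendsto_pow_atTop_nhds_zero_of_lt_one (r := (1 / 2 : ℝ)) (by norm_num)
        (by norm_num)).const_mul ‖F x‖
      simpa [div_eq_mul_inv] using this
    exact tendsto_nhds_unique h1 h2
  · have := dist_le_of_le_geometric_two_of_tendsto₀ hdist hz
    rw [dist_comm, dist_eq_norm] at this
    exact this

/-- Distance estimate to the solution set in `S` of a quadratic equation `F = 0`: a point `p`
near `x₀` is as close to it as `p` is to `S`, up to the residual `F p`. -/
theorem exists_infDist_le {E G : Type*} [NormedAddCommGroup E] [NormedSpace ℝ E]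
    [FiniteDimensional ℝ E] [NormedAddCommGroup G] [NormedSpace ℝ G] [FiniteDimensional ℝ G]
    {S : Set E} (hS : Convex ℝ S) (hSc : IsClosed S) {F : E → G} {D : E →ₗ[ℝ] G}
    {B : E →ₗ[ℝ] E →ₗ[ℝ] G} {x₀ : E} {M ρ : ℝ} (hM : 0 < M) (hρ : 0 < ρ)
    (hbd : ∀ y ∈ S, ‖y - x₀‖ ≤ M)
    (hcover : ∀ w : G, ‖w‖ ≤ ρ → ∃ y ∈ S, D (y - x₀) = w)
    (hF : ∀ H, F (x₀ + H) = D H + B H H) :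
    ∃ c > 0, ∃ η > 0, ∀ p, ∀ x ∈ S, ‖p - x₀‖ < η → ‖x - x₀‖ < η →
      Metric.infDist p {z | z ∈ S ∧ F z = 0} ≤ c * (‖p - x‖ + ‖F p‖) := by
  have : CompleteSpace E := FiniteDimensional.complete ℝ E
  have hF' : F = fun x => D.toContinuousLinearMap (x - x₀)
      + B.toContinuousBilinearMap (x - x₀) (x - x₀) := by
    funext x
    conv_lhs => rw [← add_sub_cancel x₀ x, hF]
    rfl
  have hstrict : HasStrictFDerivAt F D.toContinuousLinearMap x₀ := by
    have h1 : HasStrictFDerivAt (fun x : E => x - x₀) (ContinuousLinearMap.id ℝ E) x₀ :=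
      (hasStrictFDerivAt_id x₀).sub_const x₀
    have h2 := (D.toContinuousLinearMap.hasStrictFDerivAt.comp x₀ h1).add
      (B.toContinuousBilinearMap.hasStrictFDerivAt_of_bilinear h1 h1)
    rw [hF']
    refine h2.congr_fderiv ?_
    ext v
    simp
  have hcont : Continuous F := by
    rw [hF']
    fun_prop
  have h0 : F x₀ = 0 := by simpa using hF 0
  obtain ⟨c, hc, hev⟩ := exists_solution_near hS hSc hcont hM hρ hbd
    (F' := D.toContinuousLinearMap) hcover hstrict h0
  obtain ⟨K, s, hs, hLip⟩ := hstrict.exists_lipschitzOnWith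
  obtain ⟨η, hη, hball⟩ := Metric.eventually_nhds_iff.1 (hev.and hs)
  refine ⟨1 + c * K + c, by positivity, η, hη, fun p x hx hp hxx => ?_⟩
  obtain ⟨z, hz, hFz, hzx⟩ := (hball (by rwa [dist_eq_norm] : dist x x₀ < η)).1 hx
  have h1 : ‖F x‖ ≤ ‖F p‖ + K * ‖p - x‖ := by
    have h2 := hLip.norm_sub_le (hball (by rwa [dist_eq_norm] : dist x x₀ < η)).2
      (hball (by rwa [dist_eq_norm] : dist p x₀ < η)).2
    have h3 := norm_le_norm_add_norm_sub (F p) (F x)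
    rw [norm_sub_rev] at h3
    rw [norm_sub_rev p x]
    linarith
  calc _ ≤ dist p z :=
        Metric.infDist_le_dist_of_mem (s := {z | z ∈ S ∧ F z = 0}) (show _ ∧ _ from ⟨hz, hFz⟩)
    _ ≤ ‖p - x‖ + ‖z - x‖ := by
        rw [dist_eq_norm, norm_sub_rev z x]
        have := norm_add_le (p - x) (x - z)
        rwa [sub_add_sub_cancel] at this
    _ ≤ ‖p - x‖ + c * (‖F p‖ + K * ‖p - x‖) := by gcongr; exact hzx.trans (by gcongr)
    _ ≤ _ := by
        have : 0 ≤ (K : ℝ) := K.2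
        have h4 : 0 ≤ c * K * ‖F p‖ := by positivity
        have h5 := norm_nonneg (p - x)
        have h6 := norm_nonneg (F p)
        nlinarith

/-- A convex set whose interior misses `0` admits a nontrivial supporting functional at `0`. -/
theorem exists_functional_nonpos_of_zero_notMem_interior {G : Type*} [NormedAddCommGroup G]
    [NormedSpace ℝ G] [FiniteDimensional ℝ G] {D : Set G} (hD : Convex ℝ D) (h0 : (0 : G) ∈ D)
    (hint : (0 : G) ∉ interior D) : ∃ f : G →ₗ[ℝ] ℝ, f ≠ 0 ∧ ∀ w ∈ D, f w ≤ 0 := by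
  by_cases hne : (interior D).Nonempty
  · obtain ⟨f, hf, hf'⟩ := geometric_hahn_banach_of_nonempty_interior_point hD hint hne
    refine ⟨f, fun h => hf (ContinuousLinearMap.coe_injective h), fun w hw => ?_⟩
    simpa using hf' w hw
  · have hspan : Submodule.span ℝ D ≠ ⊤ := by
      intro htop
      apply hne
      rw [hD.interior_nonempty_iff_affineSpan_eq_top,
        AffineSubspace.affineSpan_eq_top_iff_vectorSpan_eq_top_of_nonempty ℝ G G ⟨0, h0⟩, eq_top_iff,
        ← htop, vectorSpan_eq_span_vsub_set_right ℝ h0]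
      simp
    obtain ⟨f, hf, hf'⟩ := Submodule.exists_le_ker_of_lt_top _ (lt_top_iff_ne_top.2 hspan)
    exact ⟨f, hf, fun w hw => (LinearMap.mem_ker.1 (hf' (Submodule.subset_span hw))).le⟩

/-! ### The spectral norm ball near a boundary point -/

section Ball

variable {n r : ℕ} {α : ℝ}

theorem IsTopProjection.mulVec_eq {R : Matrix (Fin n) (Fin r) ℝ} {P : Matrix (Fin r) (Fin r) ℝ}
    {δ : ℝ} (hP : IsTopProjection α R P δ) {x : Fin r → ℝ} (hx : (Rᵀ * R) *ᵥ x = α • x) :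
    P *ᵥ x = x := by
  have h0 : P *ᵥ (x - P *ᵥ x) = 0 := by
    rw [mulVec_sub, mulVec_mulVec, hP.idem, sub_self]
  have h1 : (Rᵀ * R) *ᵥ (x - P *ᵥ x) = α • (x - P *ᵥ x) := by
    rw [mulVec_sub, mulVec_mulVec, hP.eig, smul_mulVec, hx, smul_sub]
  have h2 := hP.gap _ h0
  rw [mulVec_dotProduct_mulVec, h1, dotProduct_smul, smul_eq_mul] at h2
  have h3 : (x - P *ᵥ x) ⬝ᵥ (x - P *ᵥ x) = 0 :=
    le_antisymm (by nlinarith [hP.pos]) (dotProduct_self_nonneg_real _)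
  exact (sub_eq_zero.1 (dotProduct_self_eq_zero.1 h3)).symm

theorem IsTopProjection.mul_eq {R : Matrix (Fin n) (Fin r) ℝ} {P Q : Matrix (Fin r) (Fin r) ℝ}
    {δ : ℝ} (hP : IsTopProjection α R P δ) (hQ : Rᵀ * R * Q = α • Q) : P * Q = Q := by
  ext i j
  have h : (Rᵀ * R) *ᵥ (Q *ᵥ Pi.single j 1) = α • (Q *ᵥ Pi.single j 1) := by
    rw [mulVec_mulVec, hQ, smul_mulVec]
  have := congrFun (hP.mulVec_eq h) i
  rw [mulVec_mulVec] at this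
  simpa using this

theorem IsTopProjection.eig_mulVec {R : Matrix (Fin n) (Fin r) ℝ} {P : Matrix (Fin r) (Fin r) ℝ}
    {δ : ℝ} (hP : IsTopProjection α R P δ) (x : Fin r → ℝ) :
    (Rᵀ * R) *ᵥ (P *ᵥ x) = α • (P *ᵥ x) := by
  rw [mulVec_mulVec, hP.eig, smul_mulVec]

theorem isTopSingularPair_of_eig (hα : 0 < α) {R : Matrix (Fin n) (Fin r) ℝ} {v : Fin r → ℝ}
    (hv : (Rᵀ * R) *ᵥ v = α • v) : IsTopSingularPair α R ((√α)⁻¹ • (R *ᵥ v)) v := by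
  have h0 : √α ≠ 0 := (Real.sqrt_pos.2 hα).ne'
  refine ⟨by rw [smul_smul, mul_inv_cancel₀ h0, one_smul], ?_⟩
  rw [mulVec_smul, mulVec_mulVec, hv, smul_smul]
  congr 1
  rw [inv_mul_eq_iff_eq_mul₀ h0, Real.mul_self_sqrt hα.le]

theorem GammaSet_antisymm (hα : 0 < α) {R H : Matrix (Fin n) (Fin r) ℝ} (hH : H ∈ GammaSet α R)
    {v v' : Fin r → ℝ} (hv : (Rᵀ * R) *ᵥ v = α • v) (hv' : (Rᵀ * R) *ᵥ v' = α • v') :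
    (R *ᵥ v) ⬝ᵥ (H *ᵥ v') + (R *ᵥ v') ⬝ᵥ (H *ᵥ v) = 0 := by
  have := hH _ _ _ _ (isTopSingularPair_of_eig hα hv) (isTopSingularPair_of_eig hα hv')
  rw [smul_dotProduct, smul_dotProduct, ← smul_add, smul_eq_mul, mul_eq_zero] at this
  exact this.resolve_left (inv_ne_zero (Real.sqrt_pos.2 hα).ne')

/-- `Γ_R` as a linear subspace. -/
def gammaSubmodule (α : ℝ) (R : Matrix (Fin n) (Fin r) ℝ) :
    Submodule ℝ (Matrix (Fin n) (Fin r) ℝ) where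
  carrier := GammaSet α R
  add_mem' := by
    intro H K hH hK u v u' v' h h'
    have h1 := hH u v u' v' h h'
    have h2 := hK u v u' v' h h'
    simp only [add_mulVec, dotProduct_add]
    linarith
  zero_mem' := by
    intro u v u' v' _ _
    simp
  smul_mem' := by
    intro c H hH u v u' v' h h'
    simp only [smul_mulVec, dotProduct_smul, ← smul_add, hH u v u' v' h h', smul_zero]

/-- `Γ_R` is orthogonal to the normal cone of the ball, in the factored form of the latter. -/
theorem frob_mul_eq_zero_of_mem_GammaSet (hα : 0 < α) {R H : Matrix (Fin n) (Fin r) ℝ}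
    {P Q : Matrix (Fin r) (Fin r) ℝ} {δ : ℝ} (hP : IsTopProjection α R P δ)
    (hQs : Qᵀ = Q) (hQ : Rᵀ * R * Q = α • Q) (hH : H ∈ GammaSet α R) : frob (R * Q) H = 0 := by
  have hPQ := hP.mul_eq hQ
  have hQP : Q * P = Q := by
    rw [← hQs, ← hP.symm, ← transpose_mul, hPQ]
  set B := P * (Rᵀ * H) * P with hB
  have hanti : B + Bᵀ = 0 := by
    ext i j
    have h := GammaSet_antisymm hα hH (hP.eig_mulVec (Pi.single i 1))
      (hP.eig_mulVec (Pi.single j 1))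
    have e : ∀ k l, (R *ᵥ (P *ᵥ Pi.single k 1)) ⬝ᵥ (H *ᵥ (P *ᵥ Pi.single l 1)) = B k l := by
      intro k l
      rw [mulVec_dotProduct_mulVec, mulVec_mulVec, mulVec_dotProduct_mulVec, hP.symm,
        ← Matrix.mul_assoc, ← hB]
      simp
    rw [e, e] at h
    simpa using h
  have h1 : frob (R * Q) H = (Q * B).trace := by
    calc frob (R * Q) H = (Q * (Rᵀ * H)).trace := by
          rw [frob, transpose_mul, hQs, Matrix.mul_assoc]
      _ = (P * Q * (Rᵀ * H)).trace := by rw [hPQ]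
      _ = (Q * P * (Rᵀ * H) * P).trace := by
          rw [hQP, Matrix.mul_assoc P, trace_mul_comm P]
      _ = (Q * B).trace := by simp only [hB, Matrix.mul_assoc]
  have h2 : (Q * B).trace = (Q * Bᵀ).trace := by
    rw [← trace_transpose, transpose_mul, hQs, trace_mul_comm]
  have h3 : (Q * B).trace + (Q * Bᵀ).trace = 0 := by
    rw [← trace_add, ← Matrix.mul_add, hanti]; simp
  rw [h1]; linarith

theorem two_mul_dotProduct_le {m : ℕ} (p q : Fin m → ℝ) {c : ℝ} (hc : 0 < c) :
    2 * (p ⬝ᵥ q) ≤ c⁻¹ * (p ⬝ᵥ p) + c * (q ⬝ᵥ q) := by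
  have h := dotProduct_self_nonneg_real (p - c • q)
  simp only [sub_dotProduct, dotProduct_sub, smul_dotProduct, dotProduct_smul, smul_eq_mul,
    dotProduct_comm q p] at h
  have h2 : 0 ≤ c⁻¹ * ((p ⬝ᵥ p) - c * (p ⬝ᵥ q) - (c * (p ⬝ᵥ q) - c * (c * (q ⬝ᵥ q)))) := by
    exact mul_nonneg (inv_nonneg.2 hc.le) (by linarith)
  have h3 : c⁻¹ * ((p ⬝ᵥ p) - c * (p ⬝ᵥ q) - (c * (p ⬝ᵥ q) - c * (c * (q ⬝ᵥ q))))
      = c⁻¹ * (p ⬝ᵥ p) + c * (q ⬝ᵥ q) - 2 * (p ⬝ᵥ q) := by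
    field_simp; ring
  linarith

theorem exists_mulVec_bound (H : Matrix (Fin n) (Fin r) ℝ) :
    ∃ c > 0, ∀ x, (H *ᵥ x) ⬝ᵥ (H *ᵥ x) ≤ c * (x ⬝ᵥ x) := by
  refine ⟨specNorm H ^ 2 + 1, by positivity, (specNorm_le_iff (by positivity) H).1 ?_⟩
  exact Real.le_sqrt_of_sq_le (by linarith)

/-- Decomposition of a vector along the top right singular space and its complement; the images
under `R` of the two components are orthogonal. -/
theorem IsTopProjection.decomp {R : Matrix (Fin n) (Fin r) ℝ} {P : Matrix (Fin r) (Fin r) ℝ}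
    {δ : ℝ} (hP : IsTopProjection α R P δ) (x : Fin r → ℝ) :
    ∃ p y, x = p + y ∧ (Rᵀ * R) *ᵥ p = α • p ∧ P *ᵥ y = 0 ∧ p ⬝ᵥ y = 0 ∧
      (R *ᵥ p) ⬝ᵥ (R *ᵥ y) = 0 ∧ (R *ᵥ p) ⬝ᵥ (R *ᵥ p) = α * (p ⬝ᵥ p) ∧
      x ⬝ᵥ x = p ⬝ᵥ p + y ⬝ᵥ y := by
  have h0 : P *ᵥ (x - P *ᵥ x) = 0 := by
    rw [mulVec_sub, mulVec_mulVec, hP.idem, sub_self]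
  have h1 : (P *ᵥ x) ⬝ᵥ (x - P *ᵥ x) = 0 := by
    have := mulVec_dotProduct_mulVec P 1 x (x - P *ᵥ x)
    rwa [one_mulVec, hP.symm, Matrix.mul_one, h0, dotProduct_zero] at this
  refine ⟨P *ᵥ x, x - P *ᵥ x, by abel, hP.eig_mulVec x, h0, h1, ?_, ?_, ?_⟩
  · rw [dotProduct_comm, mulVec_dotProduct_mulVec, hP.eig_mulVec, dotProduct_smul,
      dotProduct_comm, h1, smul_zero]
  · rw [mulVec_dotProduct_mulVec, hP.eig_mulVec, dotProduct_smul, smul_eq_mul]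
  · conv_lhs => rw [show x = P *ᵥ x + (x - P *ᵥ x) by abel]
    rw [add_dotProduct, dotProduct_add, dotProduct_add, h1,
      dotProduct_comm (x - P *ᵥ x) (P *ᵥ x), h1]
    ring

/-- Directions in `Γ_R` are tangent to the ball to second order. -/
theorem exists_quadratic_bound_of_mem_GammaSet (hα : 0 < α) {R H : Matrix (Fin n) (Fin r) ℝ}
    {P : Matrix (Fin r) (Fin r) ℝ} {δ : ℝ} (hR : R ∈ OmegaTwo n r α)
    (hP : IsTopProjection α R P δ) (hH : H ∈ GammaSet α R) :
    ∃ K > 0, ∀ (t : ℝ) (x : Fin r → ℝ),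
      ((R + t • H) *ᵥ x) ⬝ᵥ ((R + t • H) *ᵥ x) ≤ (α + K * t ^ 2) * (x ⬝ᵥ x) := by
  obtain ⟨c, hc, hcH⟩ := exists_mulVec_bound H
  have hδ := hP.pos
  have hl : 0 < δ / (2 * c) := by positivity
  have hm : 0 < δ / (2 * α) := by positivity
  refine ⟨(δ / (2 * c))⁻¹ * α + (δ / (2 * α))⁻¹ * c + c, by positivity, fun t x => ?_⟩
  obtain ⟨p, y, hx, hpe, hy, hpy, hRpy, hRp, hxx⟩ := hP.decomp x
  have g0 := hP.gap y hy
  have g1 : (R *ᵥ p) ⬝ᵥ (H *ᵥ p) = 0 := by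
    have := GammaSet_antisymm hα hH hpe hpe
    linarith
  have g2 := two_mul_dotProduct_le (t • (R *ᵥ p)) (H *ᵥ y) hl
  have g3 := two_mul_dotProduct_le (t • (H *ᵥ x)) (R *ᵥ y) hm
  have g4 := (mem_OmegaTwo_iff hα.le).1 hR y
  have g5 := hcH y
  have g6 := hcH x
  have hpp := dotProduct_self_nonneg_real p
  have hyy := dotProduct_self_nonneg_real y
  simp only [smul_dotProduct, dotProduct_smul, smul_eq_mul, hRp] at g2 g3
  have e1 : ((R + t • H) *ᵥ x) ⬝ᵥ ((R + t • H) *ᵥ x)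
      = (R *ᵥ x) ⬝ᵥ (R *ᵥ x) + 2 * t * ((R *ᵥ x) ⬝ᵥ (H *ᵥ x))
        + t ^ 2 * ((H *ᵥ x) ⬝ᵥ (H *ᵥ x)) := by
    simp only [add_mulVec, smul_mulVec, dotProduct_add, add_dotProduct, smul_dotProduct,
      dotProduct_smul, smul_eq_mul, dotProduct_comm (H *ᵥ x) (R *ᵥ x)]
    ring
  have e2 : (R *ᵥ x) ⬝ᵥ (R *ᵥ x) = α * (p ⬝ᵥ p) + (R *ᵥ y) ⬝ᵥ (R *ᵥ y) := by
    rw [hx]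
    simp only [mulVec_add, dotProduct_add, add_dotProduct, hRpy, hRp,
      dotProduct_comm (R *ᵥ y) (R *ᵥ p)]
    ring
  have e3 : (R *ᵥ x) ⬝ᵥ (H *ᵥ x) = (R *ᵥ p) ⬝ᵥ (H *ᵥ y) + (H *ᵥ x) ⬝ᵥ (R *ᵥ y) := by
    have : (R *ᵥ x) ⬝ᵥ (H *ᵥ x) = (R *ᵥ p) ⬝ᵥ (H *ᵥ x) + (R *ᵥ y) ⬝ᵥ (H *ᵥ x) := by
      rw [← add_dotProduct, ← mulVec_add, ← hx]
    rw [this, dotProduct_comm (R *ᵥ y)]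
    congr 1
    rw [hx, mulVec_add, dotProduct_add, g1, zero_add]
  have g7 : δ / (2 * c) * ((H *ᵥ y) ⬝ᵥ (H *ᵥ y)) ≤ δ / 2 * (y ⬝ᵥ y) := by
    calc _ ≤ δ / (2 * c) * (c * (y ⬝ᵥ y)) := by gcongr
      _ = _ := by field_simp
  have g8 : δ / (2 * α) * ((R *ᵥ y) ⬝ᵥ (R *ᵥ y)) ≤ δ / 2 * (y ⬝ᵥ y) := by
    calc _ ≤ δ / (2 * α) * (α * (y ⬝ᵥ y)) := by gcongr
      _ = _ := by field_simp
  have g9 : t ^ 2 * ((H *ᵥ x) ⬝ᵥ (H *ᵥ x)) ≤ t ^ 2 * (c * (x ⬝ᵥ x)) := by gcongr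
  have g10 : (δ / (2 * α))⁻¹ * (t * (t * ((H *ᵥ x) ⬝ᵥ (H *ᵥ x))))
      ≤ (δ / (2 * α))⁻¹ * (t ^ 2 * (c * (x ⬝ᵥ x))) := by
    rw [← mul_assoc t t, ← sq]
    gcongr
  have g11 : (δ / (2 * c))⁻¹ * (t * (t * (α * (p ⬝ᵥ p))))
      ≤ (δ / (2 * c))⁻¹ * (t ^ 2 * (α * (x ⬝ᵥ x))) := by
    rw [← mul_assoc t t, ← sq]
    gcongr
    linarith
  rw [e1, e2, e3]
  nlinarith

/-- Rescaling `R + t H` puts it back into the ball at a cost of order `t²`. -/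
theorem exists_mem_OmegaTwo_near (hα : 0 < α) {R H : Matrix (Fin n) (Fin r) ℝ}
    {P : Matrix (Fin r) (Fin r) ℝ} {δ : ℝ} (hR : R ∈ OmegaTwo n r α)
    (hP : IsTopProjection α R P δ) (hH : H ∈ GammaSet α R) :
    ∃ c > 0, ∀ t : ℝ, 0 ≤ t → t ≤ 2 → ∃ Y ∈ OmegaTwo n r α, ‖Y - (R + t • H)‖ ≤ c * t ^ 2 := by
  obtain ⟨K, hK, hb⟩ := exists_quadratic_bound_of_mem_GammaSet hα hR hP hH
  refine ⟨K / α * (‖R‖ + 2 * ‖H‖ + 1), by positivity, fun t ht0 ht2 => ?_⟩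
  have hD : 0 < α + K * t ^ 2 := by positivity
  set θ := α / (α + K * t ^ 2) with hθ
  have hθ0 : 0 ≤ θ := by positivity
  have hθ1 : θ ≤ 1 := (div_le_one hD).2 (by nlinarith [sq_nonneg t])
  have hθD : θ * (α + K * t ^ 2) = α := by rw [hθ]; field_simp
  refine ⟨θ • (R + t • H), ?_, ?_⟩
  · rw [mem_OmegaTwo_iff hα.le]
    intro x
    have hxx := dotProduct_self_nonneg_real x
    rw [smul_mulVec, smul_dotProduct, dotProduct_smul, smul_eq_mul, smul_eq_mul]
    calc _ ≤ θ * (θ * ((α + K * t ^ 2) * (x ⬝ᵥ x))) := by gcongr; exact hb t x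
      _ = θ * (α * (x ⬝ᵥ x)) := by rw [← mul_assoc θ (_ + _), hθD]
      _ ≤ 1 * (α * (x ⬝ᵥ x)) := by gcongr
      _ = _ := one_mul _
  · have h1 : θ • (R + t • H) - (R + t • H) = -((1 - θ) • (R + t • H)) := by
      rw [sub_smul, one_smul]; abel
    rw [h1, norm_neg, norm_smul, Real.norm_of_nonneg (by linarith)]
    have h2 : 1 - θ ≤ K / α * t ^ 2 := by
      have : 1 - θ = K * t ^ 2 / (α + K * t ^ 2) := by rw [hθ]; field_simp; ring
      rw [this, div_mul_eq_mul_div]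
      gcongr
      nlinarith [sq_nonneg t]
    have h3 : ‖R + t • H‖ ≤ ‖R‖ + 2 * ‖H‖ + 1 := by
      have := norm_add_le R (t • H)
      rw [norm_smul, Real.norm_of_nonneg ht0] at this
      nlinarith [norm_nonneg H]
    calc _ ≤ K / α * t ^ 2 * (‖R‖ + 2 * ‖H‖ + 1) := by gcongr
      _ = _ := by ring

/-- If `R v = 0` and `u` is orthogonal to the top left singular vectors, a small multiple of `u vᵀ`
can be added to `R` without leaving the ball. -/
theorem exists_add_smul_vecMulVec_mem (hα : 0 < α) {R : Matrix (Fin n) (Fin r) ℝ}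
    {P : Matrix (Fin r) (Fin r) ℝ} {δ : ℝ} (hR : R ∈ OmegaTwo n r α)
    (hP : IsTopProjection α R P δ) {u : Fin n → ℝ} {v : Fin r → ℝ} (hv : R *ᵥ v = 0)
    (hu : ∀ x, (Rᵀ * R) *ᵥ x = α • x → u ⬝ᵥ (R *ᵥ x) = 0) :
    ∃ s : ℝ, 0 < s ∧ R + s • vecMulVec u v ∈ OmegaTwo n r α := by
  have hδ := hP.pos
  have huu := dotProduct_self_nonneg_real u
  have hvv := dotProduct_self_nonneg_real v
  set D := 2 * ((v ⬝ᵥ v) * (u ⬝ᵥ u)) + α with hD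
  have hD0 : 0 < D := by positivity
  obtain ⟨s, hs0, hs1, hs2⟩ : ∃ s : ℝ, 0 < s ∧ s ≤ 1 ∧ s * D ≤ δ :=
    ⟨min 1 (δ / D), by positivity, min_le_left _ _, by
      calc _ ≤ δ / D * D := by gcongr; exact min_le_right _ _
        _ = δ := by field_simp⟩
  refine ⟨s, hs0, (mem_OmegaTwo_iff hα.le).2 fun x => ?_⟩
  obtain ⟨p, y, hx, hpe, hy, hpy, hRpy, hRp, hxx⟩ := hP.decomp x
  have hyy := dotProduct_self_nonneg_real y
  have hpp := dotProduct_self_nonneg_real p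
  have hvp : v ⬝ᵥ p = 0 := by
    have : α * (v ⬝ᵥ p) = 0 := by
      rw [← smul_eq_mul, ← dotProduct_smul, ← hpe, ← mulVec_dotProduct_mulVec, hv,
        zero_dotProduct]
    exact (mul_eq_zero.1 this).resolve_left hα.ne'
  have e0 : (R + s • vecMulVec u v) *ᵥ x = R *ᵥ p + (R *ᵥ y + (s * (v ⬝ᵥ y)) • u) := by
    rw [add_mulVec, smul_mulVec, vecMulVec_mulVec, hx, mulVec_add, dotProduct_add, hvp, zero_add,
      op_smul_eq_smul, smul_smul, add_assoc]
  set b := v ⬝ᵥ y with hb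
  have e1 : ((R + s • vecMulVec u v) *ᵥ x) ⬝ᵥ ((R + s • vecMulVec u v) *ᵥ x)
      = α * (p ⬝ᵥ p) + (R *ᵥ y) ⬝ᵥ (R *ᵥ y) + s * (2 * ((b • u) ⬝ᵥ (R *ᵥ y)))
        + s ^ 2 * (b ^ 2 * (u ⬝ᵥ u)) := by
    rw [e0]
    simp only [dotProduct_add, add_dotProduct, smul_dotProduct, dotProduct_smul, smul_eq_mul,
      hRpy, hRp, hu p hpe, dotProduct_comm (R *ᵥ y) (R *ᵥ p), dotProduct_comm (R *ᵥ p) u,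
      dotProduct_comm (R *ᵥ y) u]
    ring
  have g0 := hP.gap y hy
  have g1 := two_mul_dotProduct_le (b • u) (R *ᵥ y) one_pos
  have g2 := (mem_OmegaTwo_iff hα.le).1 hR y
  have g3 : b ^ 2 ≤ (v ⬝ᵥ v) * (y ⬝ᵥ y) := dotProduct_sq_le v y
  have g4 : b ^ 2 * (u ⬝ᵥ u) ≤ (v ⬝ᵥ v) * (y ⬝ᵥ y) * (u ⬝ᵥ u) := by gcongr
  have g5 : (b • u) ⬝ᵥ (b • u) = b ^ 2 * (u ⬝ᵥ u) := by
    rw [smul_dotProduct, dotProduct_smul, smul_eq_mul, smul_eq_mul]; ring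
  rw [g5, inv_one, one_mul, one_mul] at g1
  have g6 : s * (2 * ((b • u) ⬝ᵥ (R *ᵥ y)))
      ≤ s * ((v ⬝ᵥ v) * (y ⬝ᵥ y) * (u ⬝ᵥ u) + α * (y ⬝ᵥ y)) := by
    gcongr; linarith
  have g7 : s ^ 2 * (b ^ 2 * (u ⬝ᵥ u)) ≤ s * ((v ⬝ᵥ v) * (y ⬝ᵥ y) * (u ⬝ᵥ u)) := by
    have : s ^ 2 ≤ s := by nlinarith
    gcongr
  have g8 : s * D * (y ⬝ᵥ y) ≤ δ * (y ⬝ᵥ y) := by gcongr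
  rw [e1, hxx]
  rw [hD] at g8
  nlinarith

theorem convex_OmegaTwo : Convex ℝ (OmegaTwo n r α) := by
  intro X hX Y hY a b ha hb hab
  have hX' : specNorm X ≤ √α := hX
  have hY' : specNorm Y ≤ √α := hY
  change specNorm _ ≤ √α
  have h1 : specNorm (a • X + b • Y) ≤ a * specNorm X + b * specNorm Y := by
    unfold specNorm
    simp only [map_add, map_smul]
    refine (norm_add_le _ _).trans ?_
    rw [norm_smul, norm_smul, Real.norm_of_nonneg ha, Real.norm_of_nonneg hb]
  calc _ ≤ a * √α + b * √α := h1.trans (by gcongr)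
    _ = √α := by rw [← add_mul, hab, one_mul]

theorem continuous_specNorm :
    Continuous (specNorm : Matrix (Fin n) (Fin r) ℝ → ℝ) := by
  let L : Matrix (Fin n) (Fin r) ℝ →ₗ[ℝ]
      (EuclideanSpace ℝ (Fin r) →L[ℝ] EuclideanSpace ℝ (Fin n)) :=
    (LinearMap.toContinuousLinearMap.toLinearMap) ∘ₗ (Matrix.toEuclideanLin).toLinearMap
  exact (L.continuous_of_finiteDimensional).norm

theorem isClosed_OmegaTwo : IsClosed (OmegaTwo n r α) :=
  isClosed_le continuous_specNorm continuous_const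

theorem exists_norm_bound_OmegaTwo (hα : 0 ≤ α) (R : Matrix (Fin n) (Fin r) ℝ) :
    ∃ M > 0, ∀ Y ∈ OmegaTwo n r α, ‖Y - R‖ ≤ M := by
  refine ⟨(∑ _i : Fin n, ∑ _j : Fin r, α) ^ (1 / 2 : ℝ) + ‖R‖ + 1, by positivity, fun Y hY => ?_⟩
  have h1 : ‖Y‖ ≤ (∑ _i : Fin n, ∑ _j : Fin r, α) ^ (1 / 2 : ℝ) := by
    rw [frobenius_norm_def]
    refine Real.rpow_le_rpow (by positivity) ?_ (by norm_num)
    refine Finset.sum_le_sum fun i _ => Finset.sum_le_sum fun j _ => ?_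
    have h2 := (mem_OmegaTwo_iff hα).1 hY (Pi.single j 1)
    rw [mulVec_single_one] at h2
    have h3 : Y i j * Y i j ≤ Y.col j ⬝ᵥ Y.col j :=
      Finset.single_le_sum (f := fun k => Y k j * Y k j) (fun k _ => mul_self_nonneg _)
        (Finset.mem_univ i)
    have h4 : (Pi.single j 1 : Fin r → ℝ) ⬝ᵥ Pi.single j 1 = 1 := by simp
    rw [h4, mul_one] at h2
    rw [Real.rpow_two, Real.norm_eq_abs, sq_abs, sq]
    exact h3.trans h2
  calc _ ≤ ‖Y‖ + ‖R‖ := norm_sub_le _ _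
    _ ≤ _ := by linarith

end Ball

/-! ### Tangent directions of the feasible set at a regular point -/

section Tangents

variable {n k r : ℕ} {α : ℝ} {A : SymMat n →ₗ[ℝ] (Fin k → ℝ)} {b : Fin k → ℝ}

theorem symProd_comm (X H : Matrix (Fin n) (Fin r) ℝ) : symProd X H = symProd H X := by
  apply Subtype.ext
  simp [symProd, add_comm]

theorem gramSym_eq_symProd (X : Matrix (Fin n) (Fin r) ℝ) : gramSym X = symProd X X := by
  apply Subtype.ext
  simp only [gramSym, symProd, LinearMap.coe_mk, AddHom.coe_mk, ← two_smul ℝ, smul_smul]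
  norm_num

theorem symProd_add_left (X Y H : Matrix (Fin n) (Fin r) ℝ) :
    symProd (X + Y) H = symProd X H + symProd Y H := by
  rw [symProd_comm, map_add, symProd_comm H X, symProd_comm H Y]

theorem symProd_smul_left (c : ℝ) (X H : Matrix (Fin n) (Fin r) ℝ) :
    symProd (c • X) H = c • symProd X H := by
  rw [symProd_comm, map_smul, symProd_comm H X]

/-- The equality constraints of SDPLR1, scaled so that their derivative at `R` is `g_R`. -/
def constraintMap (A : SymMat n →ₗ[ℝ] (Fin k → ℝ)) (b : Fin k → ℝ)
    (R : Matrix (Fin n) (Fin r) ℝ) : (Fin k → ℝ) × (Fin r → ℝ) :=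
  ((1 / 2 : ℝ) • (A (gramSym R) - b), Rᵀ *ᵥ ones n)

/-- The quadratic part of `constraintMap`, as a bilinear map. -/
def constraintQuad (A : SymMat n →ₗ[ℝ] (Fin k → ℝ)) :
    Matrix (Fin n) (Fin r) ℝ →ₗ[ℝ] Matrix (Fin n) (Fin r) ℝ →ₗ[ℝ] (Fin k → ℝ) × (Fin r → ℝ) :=
  LinearMap.mk₂ ℝ (fun X H => ((1 / 2 : ℝ) • A (symProd X H), 0))
    (fun X Y H => by simp [symProd_add_left])
    (fun c X H => by simp [symProd_smul_left, smul_comm c])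
    (fun X H K => by simp)
    (fun c X H => by simp [smul_comm c])

theorem constraintQuad_apply (X H : Matrix (Fin n) (Fin r) ℝ) :
    constraintQuad A X H = ((1 / 2 : ℝ) • A (symProd X H), 0) := rfl

theorem lrFeasible_eq :
    lrFeasible r A b α = {R | R ∈ OmegaTwo n r α ∧ constraintMap A b R = 0} := by
  ext R
  simp only [lrFeasible, constraintMap, Set.mem_ofPred_eq, Prod.mk_eq_zero, smul_eq_zero,
    sub_eq_zero]
  norm_num
  tauto

theorem constraintMap_add {R : Matrix (Fin n) (Fin r) ℝ} (hR : constraintMap A b R = 0)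
    (H : Matrix (Fin n) (Fin r) ℝ) :
    constraintMap A b (R + H) = gMap A R H + constraintQuad A H H := by
  have h : constraintMap A b (R + H)
      = constraintMap A b R + (gMap A R H + constraintQuad A H H) := by
    simp only [constraintMap, gMap, constraintQuad_apply, gramSym_eq_symProd, map_add,
      symProd_add_left, symProd_comm H R, LinearMap.coe_mk, AddHom.coe_mk, Prod.mk_add_mk,
      transpose_add, add_mulVec, add_zero]
    congr 1
    ext i
    simp only [Pi.add_apply, Pi.sub_apply, Pi.smul_apply, smul_eq_mul]
    ring
  rw [h, hR, zero_add]

theorem exists_dotProduct_repr (f : (Fin k → ℝ) × (Fin r → ℝ) →ₗ[ℝ] ℝ) :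
    ∃ p : (Fin k → ℝ) × (Fin r → ℝ), ∀ w, f w = p.1 ⬝ᵥ w.1 + p.2 ⬝ᵥ w.2 := by
  refine ⟨(fun i => f (Pi.single i 1, 0), fun j => f (0, Pi.single j 1)), fun w => ?_⟩
  have h1 : w = (∑ i, w.1 i • ((Pi.single i 1, 0) : (Fin k → ℝ) × (Fin r → ℝ)))
      + ∑ j, w.2 j • ((0, Pi.single j 1) : (Fin k → ℝ) × (Fin r → ℝ)) := by
    apply Prod.ext
    · ext i
      simp [Prod.fst_sum, Finset.sum_apply, Pi.single_apply]
    · ext i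
      simp [Prod.snd_sum, Finset.sum_apply, Pi.single_apply]
  conv_lhs => rw [h1]
  simp only [map_add, map_sum, map_smul, smul_eq_mul, dotProduct]
  congr 1 <;> exact Finset.sum_congr rfl fun i _ => mul_comm _ _

/-- Constraint nondegeneracy implies Robinson's constraint qualification: a functional `ℓ`
separating `0` from `g_R(Ω - R)` would make `g_R*(ℓ)` a normal vector of the ball, which vanishes
on `Γ_R`. -/
theorem exists_cover_of_isRegularPoint (hα : 0 < α) {R : Matrix (Fin n) (Fin r) ℝ}
    {P : Matrix (Fin r) (Fin r) ℝ} {δ : ℝ} (hP : IsTopProjection α R P δ)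
    (hreg : IsRegularPoint A b α R) :
    ∃ ρ > 0, ∀ w, ‖w‖ ≤ ρ → ∃ Y ∈ OmegaTwo n r α, gMap A R (Y - R) = w := by
  have hR : R ∈ OmegaTwo n r α := hreg.1.2.2
  set D := (fun Y => gMap A R (Y - R)) '' OmegaTwo n r α with hD
  have hconv : Convex ℝ D := by
    rintro _ ⟨X, hX, rfl⟩ _ ⟨Y, hY, rfl⟩ s t hs ht hst
    refine ⟨s • X + t • Y, convex_OmegaTwo hX hY hs ht hst, ?_⟩
    change gMap A R (s • X + t • Y - R) = s • gMap A R (X - R) + t • gMap A R (Y - R)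
    rw [← map_smul, ← map_smul, ← map_add]
    congr 1
    have : R = s • R + t • R := by rw [← add_smul, hst, one_smul]
    conv_lhs => rw [this]
    rw [smul_sub, smul_sub]; abel
  have h0 : (0 : (Fin k → ℝ) × (Fin r → ℝ)) ∈ D := ⟨R, hR, by simp⟩
  have hint : (0 : (Fin k → ℝ) × (Fin r → ℝ)) ∈ interior D := by
    by_contra hcon
    obtain ⟨f, hf, hfD⟩ := exists_functional_nonpos_of_zero_notMem_interior hconv h0 hcon
    obtain ⟨p, hp⟩ := exists_dotProduct_repr f
    have hN : gAdjoint A R p ∈ normalCone (OmegaTwo n r α) R := by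
      intro Y hY
      rw [frob_gAdjoint, ← hp]
      exact hfD _ ⟨Y, hY, rfl⟩
    obtain ⟨Q, hQ, hΘ, hRQ⟩ := exists_eq_mul_of_mem_normalCone hα hR hN
    apply hf
    refine LinearMap.ext fun w => ?_
    have : w ∈ gMap A R '' GammaSet α R := by rw [hreg.2]; trivial
    obtain ⟨H, hH, rfl⟩ := this
    rw [LinearMap.zero_apply, hp, ← frob_gAdjoint, hΘ]
    exact frob_mul_eq_zero_of_mem_GammaSet hα hP (posSemidef_iff_real.1 hQ).1 hRQ hH
  obtain ⟨ρ, hρ, hball⟩ := Metric.nhds_basis_closedBall.mem_iff.1 (mem_interior_iff_mem_nhds.1 hint)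
  refine ⟨ρ, hρ, fun w hw => ?_⟩
  exact hball (by simpa [dist_eq_norm] using hw)

theorem exists_infDist_lrFeasible_le (hα : 0 < α) {R : Matrix (Fin n) (Fin r) ℝ}
    {P : Matrix (Fin r) (Fin r) ℝ} {δ : ℝ} (hP : IsTopProjection α R P δ)
    (hreg : IsRegularPoint A b α R) :
    ∃ c > 0, ∃ η > 0, ∀ p, ∀ x ∈ OmegaTwo n r α, ‖p - R‖ < η → ‖x - R‖ < η →
      Metric.infDist p (lrFeasible r A b α) ≤ c * (‖p - x‖ + ‖constraintMap A b p‖) := by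
  obtain ⟨M, hM, hbd⟩ := exists_norm_bound_OmegaTwo hα.le R
  obtain ⟨ρ, hρ, hcover⟩ := exists_cover_of_isRegularPoint hα hP hreg
  have hR0 : R ∈ {R | R ∈ OmegaTwo n r α ∧ constraintMap A b R = 0} := lrFeasible_eq ▸ hreg.1
  rw [lrFeasible_eq]
  exact exists_infDist_le convex_OmegaTwo isClosed_OmegaTwo hM hρ hbd hcover
    (fun H => constraintMap_add hR0.2 H)

/-- A curve `p` through `R` that satisfies all constraints up to `O(tʲ)` is within `O(tʲ)` of the
feasible set. -/
theorem infDist_lrFeasible_isLittleO (hα : 0 < α) {R : Matrix (Fin n) (Fin r) ℝ}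
    {P : Matrix (Fin r) (Fin r) ℝ} {δ : ℝ} (hP : IsTopProjection α R P δ)
    (hreg : IsRegularPoint A b α R) {p : ℝ → Matrix (Fin n) (Fin r) ℝ}
    (hp : Tendsto (fun t => ‖p t - R‖) (𝓝[>] 0) (𝓝 0)) {j : ℕ} {C : ℝ}
    (hball : ∀ t, 0 < t → t ≤ 1 / 2 → ∃ x ∈ OmegaTwo n r α, ‖p t - x‖ ≤ C * t ^ (j + 1))
    (hcon : ∀ t, 0 < t → t ≤ 1 / 2 → ‖constraintMap A b (p t)‖ ≤ C * t ^ (j + 1)) :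
    (fun t : ℝ => Metric.infDist (p t) (lrFeasible r A b α)) =o[𝓝[>] 0] fun t : ℝ => t ^ j := by
  obtain ⟨c, hc, η, hη, hd⟩ := exists_infDist_lrFeasible_le hα hP hreg
  have hpow : Tendsto (fun t : ℝ => C * t ^ (j + 1)) (𝓝[>] 0) (𝓝 0) := by
    have : Continuous fun t : ℝ => C * t ^ (j + 1) := by fun_prop
    have h := this.tendsto 0
    simp only [ne_eq, Nat.add_eq_zero_iff, one_ne_zero, and_false, not_false_eq_true, zero_pow,
      mul_zero] at h
    exact h.mono_left nhdsWithin_le_nhds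
  have hO : (fun t : ℝ => Metric.infDist (p t) (lrFeasible r A b α)) =O[𝓝[>] 0]
      fun t : ℝ => t ^ (j + 1) := by
    refine IsBigO.of_bound (c * (C + C)) ?_
    filter_upwards [self_mem_nhdsWithin, nhdsWithin_le_nhds (Iic_mem_nhds
      (show (0 : ℝ) < 1 / 2 by norm_num)), hp.eventually_lt_const (half_pos hη),
      hpow.eventually_lt_const (half_pos hη)] with t ht0 ht1 ht2 ht3
    have ht0' : 0 < t := ht0
    obtain ⟨x, hx, hpx⟩ := hball t ht0 ht1
    have h1 : ‖x - R‖ < η := by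
      have := norm_add_le (x - p t) (p t - R)
      rw [sub_add_sub_cancel, norm_sub_rev x (p t)] at this
      linarith
    have h2 := hd (p t) x hx (by linarith) h1
    rw [Real.norm_of_nonneg Metric.infDist_nonneg, Real.norm_of_nonneg (by positivity)]
    calc _ ≤ _ := h2
      _ ≤ c * (C * t ^ (j + 1) + C * t ^ (j + 1)) := by
          gcongr
          exact hcon t ht0 ht1
      _ = _ := by ring
  exact hO.trans_isLittleO ((isLittleO_pow_pow (Nat.lt_succ_self j)).mono nhdsWithin_le_nhds)

/-- The segment towards a point `Y` of the ball can be corrected along `Γ_R` to a tangent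
direction of the feasible set. -/
theorem mem_innerTangentCone (hα : 0 < α) {R : Matrix (Fin n) (Fin r) ℝ}
    {P : Matrix (Fin r) (Fin r) ℝ} {δ : ℝ} (hP : IsTopProjection α R P δ)
    (hreg : IsRegularPoint A b α R) {Y H : Matrix (Fin n) (Fin r) ℝ}
    (hY : Y ∈ OmegaTwo n r α) (hH : H ∈ GammaSet α R) (hg : gMap A R (Y - R + H) = 0) :
    Y - R + H ∈ innerTangentCone (lrFeasible r A b α) R := by
  have hR : R ∈ OmegaTwo n r α := hreg.1.2.2
  have hR0 : constraintMap A b R = 0 := by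
    have : R ∈ {R | R ∈ OmegaTwo n r α ∧ constraintMap A b R = 0} := lrFeasible_eq ▸ hreg.1
    exact this.2
  obtain ⟨c, hc, hnear⟩ := exists_mem_OmegaTwo_near hα hR hP hH
  set h := Y - R + H with hh
  set q := ‖constraintQuad A h h‖ with hq
  have key := infDist_lrFeasible_isLittleO hα hP hreg (p := fun t => R + t • h) (j := 1)
    (C := 2 * c + q) ?_ ?_ ?_
  · simpa [innerTangentCone] using key
  · have : Continuous fun t : ℝ => ‖t • h‖ := by fun_prop
    have h2 := this.tendsto 0
    simp only [zero_smul, norm_zero] at h2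
    simpa using h2.mono_left nhdsWithin_le_nhds
  · intro t ht0 ht1
    obtain ⟨X, hX, hXn⟩ := hnear (2 * t) (by linarith) (by linarith)
    have hZ : R + (2 * t) • (Y - R) ∈ OmegaTwo n r α :=
      convex_OmegaTwo.add_smul_sub_mem hR hY ⟨by linarith, by linarith⟩
    refine ⟨(1 / 2 : ℝ) • (R + (2 * t) • (Y - R)) + (1 / 2 : ℝ) • X,
      convex_OmegaTwo hZ hX (by norm_num) (by norm_num) (by norm_num), ?_⟩
    have e : R + t • h - ((1 / 2 : ℝ) • (R + (2 * t) • (Y - R)) + (1 / 2 : ℝ) • X)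
        = -((1 / 2 : ℝ) • (X - (R + (2 * t) • H))) := by
      rw [hh]; module
    rw [e, norm_neg, norm_smul]
    have : 0 ≤ q * t ^ 2 := by positivity
    norm_num
    nlinarith
  · intro t ht0 ht1
    have : 0 ≤ 2 * c * t ^ 2 := by positivity
    rw [constraintMap_add hR0, map_smul, hg, smul_zero, zero_add, map_smul, map_smul,
      LinearMap.smul_apply, norm_smul, norm_smul, Real.norm_of_nonneg ht0.le, ← hq]
    have e1 : (2 * c + q) * t ^ (1 + 1) = 2 * c * t ^ 2 + t * (t * q) := by ring
    linarith

/-- Second order tangents along a direction `h` in which the ball is not binding: a correction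
`w` in `Γ_R` that cancels the second order term of the equations is enough. -/
theorem mem_innerSecondTangentSet (hα : 0 < α) {R : Matrix (Fin n) (Fin r) ℝ}
    {P : Matrix (Fin r) (Fin r) ℝ} {δ : ℝ} (hP : IsTopProjection α R P δ)
    (hreg : IsRegularPoint A b α R) {h w : Matrix (Fin n) (Fin r) ℝ}
    (hh : R + h ∈ OmegaTwo n r α) (hw : w ∈ GammaSet α R) (hgh : gMap A R h = 0)
    (hgw : gMap A R w = (-A (gramSym h), 0)) :
    w ∈ innerSecondTangentSet (lrFeasible r A b α) R h := by
  have hR : R ∈ OmegaTwo n r α := hreg.1.2.2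
  have hR0 : constraintMap A b R = 0 := by
    have : R ∈ {R | R ∈ OmegaTwo n r α ∧ constraintMap A b R = 0} := lrFeasible_eq ▸ hreg.1
    exact this.2
  obtain ⟨c, hc, hnear⟩ := exists_mem_OmegaTwo_near hα hR hP hw
  set q := ‖constraintQuad A h w‖ + ‖constraintQuad A w w‖ with hq
  have key := infDist_lrFeasible_isLittleO hα hP hreg
    (p := fun t => R + t • h + (t ^ 2 / 2) • w) (j := 2) (C := c + q) ?_ ?_ ?_
  · simpa [innerSecondTangentSet] using key
  · have : Continuous fun t : ℝ => ‖t • h + (t ^ 2 / 2) • w‖ := by fun_prop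
    have h2 := this.tendsto 0
    simp only [zero_smul, ne_eq, OfNat.ofNat_ne_zero, not_false_eq_true, zero_pow, zero_div,
      add_zero, norm_zero] at h2
    simpa [add_assoc] using h2.mono_left nhdsWithin_le_nhds
  · intro t ht0 ht1
    obtain ⟨X, hX, hXn⟩ := hnear (t ^ 2) (by positivity) (by nlinarith)
    have hZ : R + (2 * t) • h ∈ OmegaTwo n r α := by
      have := convex_OmegaTwo.add_smul_sub_mem hR hh (t := 2 * t) ⟨by linarith, by linarith⟩
      simpa using this
    refine ⟨(1 / 2 : ℝ) • (R + (2 * t) • h) + (1 / 2 : ℝ) • X,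
      convex_OmegaTwo hZ hX (by norm_num) (by norm_num) (by norm_num), ?_⟩
    have e : R + t • h + (t ^ 2 / 2) • w - ((1 / 2 : ℝ) • (R + (2 * t) • h) + (1 / 2 : ℝ) • X)
        = -((1 / 2 : ℝ) • (X - (R + t ^ 2 • w))) := by
      module
    rw [e, norm_neg, norm_smul]
    have h1 : 0 ≤ q * t ^ 3 := by positivity
    have h2 : c * (t ^ 2) ^ 2 ≤ c * t ^ 3 := by
      gcongr
      rw [← pow_mul]
      exact pow_le_pow_of_le_one ht0.le (by linarith) (by norm_num)
    have h3 : 0 ≤ c * t ^ 3 := by positivity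
    norm_num
    nlinarith
  · intro t ht0 ht1
    have e : constraintMap A b (R + t • h + (t ^ 2 / 2) • w)
        = t ^ 3 • constraintQuad A h w + (t ^ 4 / 4) • constraintQuad A w w := by
      have e1 : ((-A (gramSym h), 0) : (Fin k → ℝ) × (Fin r → ℝ))
          = (-2 : ℝ) • constraintQuad A h h := by
        simp [constraintQuad_apply, gramSym_eq_symProd, smul_smul]
      have e2 : constraintQuad A w h = constraintQuad A h w := by
        rw [constraintQuad_apply, symProd_comm, constraintQuad_apply]
      rw [add_assoc, constraintMap_add hR0, map_add, map_smul, map_smul, hgh, hgw, e1]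
      simp only [map_add, map_smul, LinearMap.add_apply, LinearMap.smul_apply, e2]
      module
    rw [e]
    have h2 : t ^ 4 / 4 ≤ t ^ 3 := by
      have : t ^ 4 ≤ t ^ 3 := pow_le_pow_of_le_one ht0.le (by linarith) (by norm_num)
      have : 0 ≤ t ^ 4 := by positivity
      linarith
    have h3 : 0 ≤ c * t ^ 3 := by positivity
    calc _ ≤ t ^ 3 * ‖constraintQuad A h w‖ + (t ^ 4 / 4) * ‖constraintQuad A w w‖ := by
          refine (norm_add_le _ _).trans (le_of_eq ?_)
          rw [norm_smul, norm_smul, Real.norm_of_nonneg (by positivity),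
            Real.norm_of_nonneg (by positivity)]
      _ ≤ t ^ 3 * ‖constraintQuad A h w‖ + t ^ 3 * ‖constraintQuad A w w‖ := by gcongr
      _ ≤ c * t ^ 3 + q * t ^ 3 := by rw [hq, add_mul]; linarith
      _ = _ := by ring

/-! ### First and second order conditions -/

theorem frob_sub_right {p q : ℕ} (X Y Z : Matrix (Fin p) (Fin q) ℝ) :
    frob X (Y - Z) = frob X Y - frob X Z := by
  simp [frob, Matrix.mul_sub]

theorem frob_add_right {p q : ℕ} (X Y Z : Matrix (Fin p) (Fin q) ℝ) :
    frob X (Y + Z) = frob X Y + frob X Z := by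
  simp [frob, Matrix.mul_add]

theorem frob_sub_left {p q : ℕ} (X Y Z : Matrix (Fin p) (Fin q) ℝ) :
    frob (X - Y) Z = frob X Z - frob Y Z := by
  simp [frob, Matrix.sub_mul]

theorem frob_vecMulVec {p q : ℕ} (M : Matrix (Fin p) (Fin q) ℝ) (u : Fin p → ℝ)
    (v : Fin q → ℝ) : frob M (vecMulVec u v) = u ⬝ᵥ (M *ᵥ v) := by
  rw [frob_eq_sum, dotProduct]
  refine Finset.sum_congr rfl fun i _ => ?_
  rw [mulVec, dotProduct, Finset.mul_sum]
  exact Finset.sum_congr rfl fun j _ => by rw [vecMulVec_apply]; ring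

/-- At a regular point first order stationarity yields multipliers: `f'(R)` is transported to the
constraint space by a right inverse of `g_R` with values in `Γ_R`. -/
theorem exists_isKKT (hα : 0 < α) {C : SymMat n} {R : Matrix (Fin n) (Fin r) ℝ}
    {P : Matrix (Fin r) (Fin r) ℝ} {δ : ℝ} (hP : IsTopProjection α R P δ)
    (hreg : IsRegularPoint A b α R)
    (hfirst : ∀ h ∈ innerTangentCone (lrFeasible r A b α) R,
      0 ≤ frob ((C : Matrix (Fin n) (Fin n) ℝ) * R) h) :
    ∃ y z Θ, IsKKT C A b α R y z Θ := by
  have hsurj : Function.Surjective (gMap A R ∘ₗ (gammaSubmodule α R).subtype) := by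
    intro w
    have : w ∈ gMap A R '' GammaSet α R := by rw [hreg.2]; trivial
    obtain ⟨H, hH, rfl⟩ := this
    exact ⟨⟨H, hH⟩, rfl⟩
  obtain ⟨s, hs⟩ := LinearMap.exists_rightInverse_of_surjective _ (LinearMap.range_eq_top.2 hsurj)
  let f : Matrix (Fin n) (Fin r) ℝ →ₗ[ℝ] ℝ :=
    { toFun := fun H => frob ((C : Matrix (Fin n) (Fin n) ℝ) * R) H
      map_add' := fun X Y => frob_add_right _ _ _
      map_smul' := fun c X => by simp [frob] }
  obtain ⟨p, hp⟩ := exists_dotProduct_repr (f ∘ₗ (gammaSubmodule α R).subtype ∘ₗ s)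
  refine ⟨p.1, p.2, gAdjoint A R p - (C : Matrix (Fin n) (Fin n) ℝ) * R, hreg.1, ?_, ?_⟩
  · intro Y hY
    set H : gammaSubmodule α R := s (gMap A R (Y - R)) with hH
    have hgH : gMap A R H = gMap A R (Y - R) := LinearMap.congr_fun hs (gMap A R (Y - R))
    have ht := mem_innerTangentCone hα hP hreg hY (gammaSubmodule α R |>.neg_mem H.2)
      (by rw [map_add, map_neg, hgH, add_neg_cancel])
    have h1 := hfirst _ ht
    have h2 := hp (gMap A R (Y - R))
    rw [← frob_gAdjoint] at h2
    have h3 : f H = frob (gAdjoint A R p) (Y - R) := h2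
    have h4 : f (Y - R + -(H : Matrix (Fin n) (Fin r) ℝ))
        = frob ((C : Matrix (Fin n) (Fin n) ℝ) * R) (Y - R) - f H := by
      rw [map_add, map_neg, ← sub_eq_add_neg]; rfl
    have h5 : 0 ≤ f (Y - R + -(H : Matrix (Fin n) (Fin r) ℝ)) := h1
    rw [frob_sub_left]
    linarith
  · simp only [gAdjoint, LinearMap.coe_mk, AddHom.coe_mk, Submodule.coe_sub, Matrix.sub_mul]
    abel

theorem gAdjoint_eq_of_isKKT {C : SymMat n} {R Θ : Matrix (Fin n) (Fin r) ℝ} {y : Fin k → ℝ}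
    {z : Fin r → ℝ} (h : IsKKT C A b α R y z Θ) :
    gAdjoint A R (y, z) = (C : Matrix (Fin n) (Fin n) ℝ) * R + Θ := by
  have h2 := h.2.2
  simp only [Submodule.coe_sub, Matrix.sub_mul] at h2
  simp only [gAdjoint, LinearMap.coe_mk, AddHom.coe_mk]
  rw [← neg_neg Θ, ← h2]
  abel

theorem isUnit_gMap_comp_gAdjoint {R : Matrix (Fin n) (Fin r) ℝ} (hreg : IsRegularPoint A b α R) :
    IsUnit (gMap A R ∘ₗ gAdjoint A R : Module.End ℝ ((Fin k → ℝ) × (Fin r → ℝ))) := by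
  rw [LinearMap.isUnit_iff_ker_eq_bot, LinearMap.ker_eq_bot']
  intro p hp
  have hp' : gMap A R (gAdjoint A R p) = 0 := hp
  have h1 : frob (gAdjoint A R p) (gAdjoint A R p) = 0 := by
    rw [frob_gAdjoint, hp']; simp
  have h2 : gAdjoint A R p = 0 := by
    rw [frob, ← conjTranspose_eq_transpose_of_trivial] at h1
    exact trace_conjTranspose_mul_self_eq_zero_iff.1 h1
  have : p ∈ gMap A R '' GammaSet α R := by rw [hreg.2]; trivial
  obtain ⟨H, -, hH⟩ := this
  have h3 := frob_gAdjoint A R H p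
  rw [h2, hH] at h3
  have h4 : p.1 ⬝ᵥ p.1 + p.2 ⬝ᵥ p.2 = 0 := by rw [← h3]; simp [frob]
  have h5 := dotProduct_self_nonneg_real p.1
  have h6 := dotProduct_self_nonneg_real p.2
  exact Prod.ext (dotProduct_self_eq_zero.1 (by linarith)) (dotProduct_self_eq_zero.1 (by linarith))

/-- The second order condition along `u vᵀ` with `R v = 0` shows that `C - 𝒜*(y)` is nonnegative
at every `u` orthogonal to `e` and to the top left singular vectors. -/
theorem quadForm_nonneg_of_isSecondOrderStationary (hα : 0 < α) {C : SymMat n}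
    {R Θ : Matrix (Fin n) (Fin r) ℝ} {P : Matrix (Fin r) (Fin r) ℝ} {δ : ℝ}
    (hP : IsTopProjection α R P δ) (hreg : IsRegularPoint A b α R)
    (hsos : IsSecondOrderStationary C A b α R) {y : Fin k → ℝ} {z : Fin r → ℝ}
    (hkkt : IsKKT C A b α R y z Θ) {v : Fin r → ℝ} (hv0 : v ≠ 0) (hv : R *ᵥ v = 0)
    {u : Fin n → ℝ} (hue : u ⬝ᵥ ones n = 0)
    (hu : ∀ x, (Rᵀ * R) *ᵥ x = α • x → u ⬝ᵥ (R *ᵥ x) = 0) :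
    0 ≤ u ⬝ᵥ (((C - opAdjoint A y : SymMat n) : Matrix (Fin n) (Fin n) ℝ) *ᵥ u) := by
  have hR : R ∈ OmegaTwo n r α := hreg.1.2.2
  obtain ⟨s, hs, hmem⟩ := exists_add_smul_vecMulVec_mem hα hR hP hv hu
  set h := s • vecMulVec u v with hh
  have hgh : gMap A R h = 0 := by
    have h1 : symProd R h = 0 := by
      apply Subtype.ext
      have h2 : R * hᵀ = 0 := by
        rw [hh, transpose_smul, transpose_vecMulVec, Matrix.mul_smul, mul_vecMulVec, hv]; simp
      have h3 : h * Rᵀ = 0 := by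
        rw [← transpose_eq_zero, transpose_mul, transpose_transpose, h2]
      simp [symProd, h2, h3]
    have h4 : hᵀ *ᵥ ones n = 0 := by
      rw [hh, transpose_smul, transpose_vecMulVec, smul_mulVec, vecMulVec_mulVec, hue]; simp
    simp only [gMap, LinearMap.coe_mk, AddHom.coe_mk, h1, map_zero, h4]
    rfl
  have hW : ((-A (gramSym h), 0) : (Fin k → ℝ) × (Fin r → ℝ)) ∈ gMap A R '' GammaSet α R := by
    rw [hreg.2]; trivial
  obtain ⟨w, hw, hgw⟩ := hW
  have htan : h ∈ innerTangentCone (lrFeasible r A b α) R := by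
    have := mem_innerTangentCone hα hP hreg (H := 0) hmem (gammaSubmodule α R).zero_mem
      (by rw [add_sub_cancel_left, add_zero, hgh])
    rwa [add_sub_cancel_left, add_zero] at this
  have hcrit : frob ((C : Matrix (Fin n) (Fin n) ℝ) * R) h = 0 := by
    have : frob ((C : Matrix (Fin n) (Fin n) ℝ) * R) h
        = s * frob ((C : Matrix (Fin n) (Fin n) ℝ) * R) (vecMulVec u v) := by
      simp [frob, hh]
    rw [this, frob_vecMulVec, ← mulVec_mulVec, hv]; simp
  have h2nd := hsos.2.2 h htan hcrit w (mem_innerSecondTangentSet hα hP hreg hmem hw hgh hgw)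
  obtain ⟨Q, hQ, hΘ, hRQ⟩ := exists_eq_mul_of_mem_normalCone hα hR hkkt.2.1
  have hΘw : frob Θ w = 0 := by
    rw [hΘ]
    exact frob_mul_eq_zero_of_mem_GammaSet hα hP (posSemidef_iff_real.1 hQ).1 hRQ hw
  have hCR : (C : Matrix (Fin n) (Fin n) ℝ) * R = gAdjoint A R (y, z) - Θ := by
    rw [gAdjoint_eq_of_isKKT hkkt, add_sub_cancel_right]
  have hquad : ∀ M : Matrix (Fin n) (Fin n) ℝ, Mᵀ = M →
      frob (M * h) h = s ^ 2 * (v ⬝ᵥ v) * (u ⬝ᵥ (M *ᵥ u)) := by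
    intro M hM
    have : frob (M * h) h = s ^ 2 * frob (M * vecMulVec u v) (vecMulVec u v) := by
      simp [frob, hh]; ring
    rw [this, frob_vecMulVec, mul_vecMulVec, vecMulVec_mulVec, op_smul_eq_smul, dotProduct_smul,
      smul_eq_mul]
    ring
  have hgram : ∀ S : SymMat n, frob (S : Matrix (Fin n) (Fin n) ℝ) (gramSym h : SymMat n)
      = frob ((S : Matrix (Fin n) (Fin n) ℝ) * h) h := by
    intro S
    have hS : (S : Matrix (Fin n) (Fin n) ℝ)ᵀ = S := S.2
    simp only [frob, gramSym, hS, transpose_mul]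
    rw [← Matrix.mul_assoc, trace_mul_comm, Matrix.mul_assoc]
  have hf : frob ((C : Matrix (Fin n) (Fin n) ℝ) * R) w
      = -(s ^ 2 * (v ⬝ᵥ v) * (u ⬝ᵥ ((opAdjoint A y : Matrix (Fin n) (Fin n) ℝ) *ᵥ u))) := by
    rw [hCR, frob_sub_left, hΘw, frob_gAdjoint, hgw, ← hquad _ (opAdjoint A y).2, ← hgram,
      frob_opAdjoint]
    simp
  rw [hf, hquad _ C.2] at h2nd
  have hvv : 0 < v ⬝ᵥ v := lt_of_le_of_ne (dotProduct_self_nonneg_real v)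
    (fun h0 => hv0 (dotProduct_self_eq_zero.1 h0.symm))
  rw [Submodule.coe_sub, sub_mulVec, dotProduct_sub]
  have h7 : 0 ≤ (s ^ 2 * (v ⬝ᵥ v)) * (u ⬝ᵥ ((C : Matrix (Fin n) (Fin n) ℝ) *ᵥ u)
      - u ⬝ᵥ ((opAdjoint A y : Matrix (Fin n) (Fin n) ℝ) *ᵥ u)) := by
    rw [mul_sub]; linarith
  exact nonneg_of_mul_nonneg_right h7 (by positivity)

end Tangents

/-! ### The exceptional set of cost matrices -/

section Exceptional

variable {n k : ℕ}

/-- Cost matrices `C` for which some `C - 𝒜*(y)` maps a subspace of `e^⊥` (the column space of `B`)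
into the span of `e`, although the dimension `d` of the subspace satisfies `d (d + 1) / 2 > k`. -/
def exceptionalCosts (A : SymMat n →ₗ[ℝ] (Fin k → ℝ)) : Set (SymMat n) :=
  {C | ∃ (d : ℕ) (y : Fin k → ℝ) (B : Matrix (Fin n) (Fin d) ℝ) (z : Fin d → ℝ),
    2 * k < d * (d + 1) ∧ (∀ x, B *ᵥ x = 0 → x = 0) ∧ Bᵀ *ᵥ ones n = 0 ∧
    ((C - opAdjoint A y : SymMat n) : Matrix (Fin n) (Fin n) ℝ) * B = vecMulVec (ones n) z}

/-- In coordinates where a symmetric matrix annihilates the graph `{(K x, x)}`, it equals `QᵀNQ`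
with `N` its block on the first `j` coordinates and `Q = [1, -K]`; this is the `i`-th row of `Q`.
The entry `0` is for one additional coordinate, on which the matrix vanishes. -/
def graphRow {j d : ℕ} (K : Fin j → Fin d → ℝ) (i : Fin j) : (Fin j ⊕ Fin d) ⊕ Unit → ℝ :=
  Sum.elim (Sum.elim (Pi.single i 1) fun l => -K i l) fun _ => 0

/-- Smooth parametrization, by a space of smaller dimension, of the exceptional cost matrices for
which the coordinates `σ (inr l)` can be used to parametrize the column space of `B`. -/
def exceptionalParam (A : SymMat n →ₗ[ℝ] (Fin k → ℝ)) {j d : ℕ}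
    (σ : (Fin j ⊕ Fin d) ⊕ Unit ≃ Fin n)
    (p : (Fin k → ℝ) × (Fin n → ℝ) × (Fin j → Fin d → ℝ) × (Sym2 (Fin j) → ℝ)) :
    Sym2 (Fin n) → ℝ := fun q =>
  p.1 ⬝ᵥ A (symUnit q.out.1 q.out.2) + p.2.1 q.out.1 + p.2.1 q.out.2 +
    ∑ i, ∑ i', graphRow p.2.2.1 i (σ.symm q.out.1) * p.2.2.2 s(i, i') *
      graphRow p.2.2.1 i' (σ.symm q.out.2)

theorem contDiff_graphRow {E : Type*} [NormedAddCommGroup E] [NormedSpace ℝ E] {j d : ℕ}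
    {K : E → Fin j → Fin d → ℝ} (hK : ContDiff ℝ 1 K) (i : Fin j) (a : (Fin j ⊕ Fin d) ⊕ Unit) :
    ContDiff ℝ 1 fun p => graphRow (K p) i a := by
  rcases a with (a | l) | a
  · exact contDiff_const
  · exact (contDiff_pi.1 (contDiff_pi.1 hK i) l).neg
  · exact contDiff_const

theorem contDiff_exceptionalParam (A : SymMat n →ₗ[ℝ] (Fin k → ℝ)) {j d : ℕ}
    (σ : (Fin j ⊕ Fin d) ⊕ Unit ≃ Fin n) : ContDiff ℝ 1 (exceptionalParam A σ) := by
  rw [contDiff_pi]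
  intro q
  have h1 : ContDiff ℝ 1 fun p : (Fin k → ℝ) × (Fin n → ℝ) × (Fin j → Fin d → ℝ) ×
      (Sym2 (Fin j) → ℝ) => p.1 ⬝ᵥ A (symUnit q.out.1 q.out.2) := by
    unfold dotProduct
    fun_prop
  have h2 : ContDiff ℝ 1 fun p : (Fin k → ℝ) × (Fin n → ℝ) × (Fin j → Fin d → ℝ) ×
      (Sym2 (Fin j) → ℝ) => p.2.2.1 := by fun_prop
  unfold exceptionalParam
  refine ((h1.add (by fun_prop)).add (by fun_prop)).add ?_
  refine ContDiff.sum fun i _ => ContDiff.sum fun i' _ => ?_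
  exact ((contDiff_graphRow h2 i _).mul (by fun_prop)).mul (contDiff_graphRow h2 i' _)

theorem volume_range_exceptionalParam (A : SymMat n →ₗ[ℝ] (Fin k → ℝ)) {j d : ℕ}
    (σ : (Fin j ⊕ Fin d) ⊕ Unit ≃ Fin n) (hd : 2 * k < d * (d + 1)) :
    volume (Set.range (exceptionalParam A σ)) = 0 := by
  rw [← hausdorffMeasure_pi_real]
  refine hausdorffMeasure_of_dimH_lt (d := (Fintype.card (Sym2 (Fin n)) : NNReal)) ?_
  refine (contDiff_exceptionalParam A σ).dimH_range_le.trans_lt ?_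
  have hn : n = j + d + 1 := by
    have := Fintype.card_congr σ
    simpa using this.symm
  have h1 : Module.finrank ℝ ((Fin k → ℝ) × (Fin n → ℝ) × (Fin j → Fin d → ℝ) ×
      (Sym2 (Fin j) → ℝ)) = k + (n + (j * d + (j + 1).choose 2)) := by
    simp [Module.finrank_prod, Module.finrank_pi_fintype, Sym2.card]
  have h2 : k + (n + (j * d + (j + 1).choose 2)) < (n + 1).choose 2 := by
    have h3 : ((2 * k : ℕ) : ℚ) < ((d * (d + 1) : ℕ) : ℚ) := Nat.cast_lt.2 hd
    rw [← Nat.cast_lt (α := ℚ)]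
    push_cast at h3 ⊢
    rw [Nat.cast_choose_two, Nat.cast_choose_two, hn]
    push_cast
    nlinarith
  rw [h1, Sym2.card, Fintype.card_fin]
  exact_mod_cast h2

/-- A matrix with independent columns that sum to zero has an invertible square block of rows
avoiding any prescribed row. -/
theorem exists_reindex_isUnit {d : ℕ} (B : Matrix (Fin n) (Fin d) ℝ)
    (hB : ∀ x, B *ᵥ x = 0 → x = 0) (hBe : Bᵀ *ᵥ ones n = 0) (i₀ : Fin n) :
    ∃ (j : ℕ) (σ : (Fin j ⊕ Fin d) ⊕ Unit ≃ Fin n), σ (Sum.inr ()) = i₀ ∧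
      IsUnit (B.submatrix (fun l => σ (Sum.inl (Sum.inr l))) id) := by
  classical
  have hspan : Submodule.span ℝ (Set.range fun i : {i : Fin n // i ≠ i₀} => B i.1) = ⊤ := by
    by_contra hne
    obtain ⟨f, hf, hker⟩ := Submodule.exists_le_ker_of_lt_top _ (lt_top_iff_ne_top.2 hne)
    set x : Fin d → ℝ := fun l => f (Pi.single l 1) with hx
    have hfx : ∀ w, f w = w ⬝ᵥ x := by
      intro w
      rw [LinearMap.pi_apply_eq_sum_univ f w]
      simp only [dotProduct, smul_eq_mul, hx]
      refine Finset.sum_congr rfl fun l _ => ?_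
      congr 2
      funext i
      simp [Pi.single_apply, eq_comm]
    have hz : ∀ i, i ≠ i₀ → B i ⬝ᵥ x = 0 := fun i hi => by
      rw [← hfx]
      exact LinearMap.mem_ker.1 (hker (Submodule.subset_span ⟨⟨i, hi⟩, rfl⟩))
    have hsum : ∑ i, B i ⬝ᵥ x = 0 := by
      have h1 : ones n ⬝ᵥ (B *ᵥ x) = 0 := by
        rw [dotProduct_mulVec, ← mulVec_transpose, hBe, zero_dotProduct]
      simpa [ones, dotProduct, mulVec] using h1
    have h0 : B i₀ ⬝ᵥ x = 0 := by
      rw [Finset.sum_eq_single i₀ (fun i _ hi => hz i hi) (by simp)] at hsum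
      exact hsum
    have hx0 : x = 0 := by
      apply hB
      funext i
      by_cases hi : i = i₀
      · rw [hi]; exact h0
      · exact hz i hi
    apply hf
    refine LinearMap.ext fun w => ?_
    simp [hfx, hx0]
  obtain ⟨κ, a, ha, hsp, hli⟩ :=
    exists_linearIndependent' ℝ (fun i : {i : Fin n // i ≠ i₀} => B i.1)
  have : Finite κ := Finite.of_injective a ha
  have := Fintype.ofFinite κ
  let bas := Module.Basis.mk hli (by rw [hsp, hspan])
  have hcard : Fintype.card κ = d := by
    have := Module.finrank_eq_card_basis bas
    simpa using this.symm
  let e : Fin d ≃ κ := (Fintype.equivFinOfCardEq hcard).symm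
  let g : Fin d ⊕ Unit → Fin n := Sum.elim (fun l => (a (e l)).1) fun _ => i₀
  have hg : Function.Injective g := by
    rintro (l | l) (l' | l') h
    · simp only [g, Sum.elim_inl] at h
      rw [e.injective (ha (Subtype.ext h))]
    · exact absurd h (a (e l)).2
    · exact absurd h.symm (a (e l')).2
    · rfl
  let J := {i : Fin n // i ∉ Set.range g}
  let σ₁ : (Fin d ⊕ Unit) ⊕ J ≃ Fin n :=
    (Equiv.sumCongr (Equiv.ofInjective g hg) (Equiv.refl _)).trans (Equiv.Set.sumCompl _)
  let σ : (Fin (Fintype.card J) ⊕ Fin d) ⊕ Unit ≃ Fin n :=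
    (Equiv.sumAssoc _ _ _).trans ((Equiv.sumComm _ _).trans
      ((Equiv.sumCongr (Equiv.refl _) (Fintype.equivFin J).symm).trans σ₁))
  refine ⟨_, σ, rfl, ?_⟩
  rw [← Matrix.linearIndependent_rows_iff_isUnit]
  exact hli.comp e e.injective

/-- A symmetric matrix that vanishes on row `σ (inr ())` and annihilates `B`, where `B` is the
identity on the rows `σ (inl (inr l))`, is determined by its block on the remaining coordinates. -/
theorem eq_sum_graphRow {j d : ℕ} (σ : (Fin j ⊕ Fin d) ⊕ Unit ≃ Fin n)
    {M : Matrix (Fin n) (Fin n) ℝ} (hM : Mᵀ = M) {B : Matrix (Fin n) (Fin d) ℝ}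
    (hMB : M * B = 0) (hB : ∀ l l', B (σ (Sum.inl (Sum.inr l))) l' = (1 : Matrix _ _ ℝ) l l')
    (h0 : ∀ a, M a (σ (Sum.inr ())) = 0) (a b : Fin n) :
    M a b = ∑ i, ∑ i', graphRow (fun i l => B (σ (Sum.inl (Sum.inl i))) l) i (σ.symm a) *
      M (σ (Sum.inl (Sum.inl i))) (σ (Sum.inl (Sum.inl i'))) *
      graphRow (fun i l => B (σ (Sum.inl (Sum.inl i))) l) i' (σ.symm b) := by
  set K : Fin j → Fin d → ℝ := fun i l => B (σ (Sum.inl (Sum.inl i))) l with hK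
  have hrow : ∀ c b, M c b = ∑ i', M c (σ (Sum.inl (Sum.inl i'))) * graphRow K i' (σ.symm b) := by
    intro c b
    obtain ⟨b', rfl⟩ := σ.surjective b
    rw [Equiv.symm_apply_apply]
    rcases b' with (b' | l) | b'
    · simp [graphRow, Pi.single_apply]
    · have h1 : (M * B) c l = 0 := by rw [hMB]; rfl
      rw [Matrix.mul_apply, ← σ.sum_comp, Fintype.sum_sum_type, Fintype.sum_sum_type] at h1
      simp only [hB, Matrix.one_apply, mul_ite, mul_one, mul_zero, Finset.sum_ite_eq',
        Finset.mem_univ, if_true, Finset.univ_unique, PUnit.default_eq_unit,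
        Finset.sum_singleton, h0, zero_mul, add_zero] at h1
      simp only [graphRow, Sum.elim_inl, Sum.elim_inr, mul_neg, Finset.sum_neg_distrib, hK]
      linarith
    · simp [graphRow, h0]
  have hs : ∀ c b, M c b = M b c := fun c b => by
    conv_lhs => rw [← hM]
    rfl
  rw [hs a b, hrow b a]
  refine Finset.sum_congr rfl fun i _ => ?_
  rw [hs b, hrow _ b, Finset.sum_mul]
  exact Finset.sum_congr rfl fun i' _ => by ring

theorem mem_range_exceptionalParam (A : SymMat n →ₗ[ℝ] (Fin k → ℝ)) {c : Sym2 (Fin n) → ℝ}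
    {d : ℕ} {y : Fin k → ℝ} {B : Matrix (Fin n) (Fin d) ℝ} {z : Fin d → ℝ}
    (hd : 2 * k < d * (d + 1)) (hB : ∀ x, B *ᵥ x = 0 → x = 0) (hBe : Bᵀ *ᵥ ones n = 0)
    (hS : ((symOfEntries c - opAdjoint A y : SymMat n) : Matrix (Fin n) (Fin n) ℝ) * B
      = vecMulVec (ones n) z) :
    ∃ (j : ℕ) (σ : (Fin j ⊕ Fin d) ⊕ Unit ≃ Fin n), c ∈ Set.range (exceptionalParam A σ) := by
  have hn : Nonempty (Fin n) := by
    by_contra hcon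
    rw [not_nonempty_iff] at hcon
    have hd0 : 0 < d := by
      rcases Nat.eq_zero_or_pos d with h | h
      · simp [h] at hd
      · exact h
    have h1 := hB (fun _ => 1) (Subsingleton.elim _ _)
    exact one_ne_zero (congrFun h1 ⟨0, hd0⟩)
  obtain ⟨i₀⟩ := hn
  obtain ⟨j, σ, hσ, hN⟩ := exists_reindex_isUnit B hB hBe i₀
  set N := B.submatrix (fun l => σ (Sum.inl (Sum.inr l))) id with hNdef
  set S : SymMat n := symOfEntries c - opAdjoint A y with hSdef
  -- subtracting `v eᵀ + e vᵀ` from `S` kills row `i₀` and, since `eᵀB = 0`, also the product with `B`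
  set v : Fin n → ℝ := fun i => S.1 i i₀ - S.1 i₀ i₀ / 2 with hv
  let M : Matrix (Fin n) (Fin n) ℝ := Matrix.of fun a b => S.1 a b - v a - v b
  have hSs : ∀ a b, S.1 a b = S.1 b a := fun a b => Matrix.IsSymm.apply S.2 b a
  have hM : Mᵀ = M := by
    ext a b
    simp only [M, transpose_apply, of_apply, hSs b a]
    ring
  have h0 : ∀ a, M a i₀ = 0 := fun a => by
    simp only [M, of_apply, hv]; ring
  have hMB0 : M * B = 0 := by
    have hcol : ∀ l, ∑ a, B a l = 0 := fun l => by
      have := congrFun hBe l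
      simpa [mulVec, dotProduct, ones] using this
    have h1 : ∀ a l, (M * B) a l = z l - ∑ b, v b * B b l := by
      intro a l
      have h2 : ∑ b, S.1 a b * B b l = z l := by
        have := congrFun (congrFun hS a) l
        simpa [Matrix.mul_apply, vecMulVec_apply, ones] using this
      simp only [Matrix.mul_apply, M, of_apply, sub_mul, Finset.sum_sub_distrib, h2,
        ← Finset.mul_sum, hcol, mul_zero, sub_zero]
    have h3 : ∀ l, z l - ∑ b, v b * B b l = 0 := fun l => by
      rw [← h1 i₀ l, Matrix.mul_apply]
      refine Finset.sum_eq_zero fun b _ => ?_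
      have : M i₀ b = M b i₀ := by
        conv_lhs => rw [← hM]
        rfl
      rw [this, h0, zero_mul]
    ext a l
    rw [h1, h3]; rfl
  have hdet : IsUnit N.det := (Matrix.isUnit_iff_isUnit_det N).1 hN
  have key := eq_sum_graphRow σ hM (B := B * N⁻¹)
    (by rw [← Matrix.mul_assoc, hMB0, Matrix.zero_mul])
    (by
      intro l l'
      rw [← Matrix.mul_nonsing_inv N hdet]
      rfl)
    (by rw [hσ]; exact h0)
  refine ⟨j, σ, (y, v, fun i l => (B * N⁻¹) (σ (Sum.inl (Sum.inl i))) l,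
    fun q => M (σ (Sum.inl (Sum.inl q.out.1))) (σ (Sum.inl (Sum.inl q.out.2)))), ?_⟩
  have hout : ∀ i i' : Fin j,
      M (σ (Sum.inl (Sum.inl (s(i, i') : Sym2 (Fin j)).out.1)))
        (σ (Sum.inl (Sum.inl (s(i, i') : Sym2 (Fin j)).out.2)))
      = M (σ (Sum.inl (Sum.inl i))) (σ (Sum.inl (Sum.inl i'))) := by
    intro i i'
    have h4 : s((s(i, i') : Sym2 (Fin j)).out.1, (s(i, i') : Sym2 (Fin j)).out.2) = s(i, i') :=
      Quot.out_eq _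
    rcases Sym2.eq_iff.1 h4 with ⟨h5, h6⟩ | ⟨h5, h6⟩
    · rw [h5, h6]
    · rw [h5, h6]
      conv_lhs => rw [← hM]
      rfl
  funext q
  have hq : s(q.out.1, q.out.2) = q := Quot.out_eq q
  have hk := key q.out.1 q.out.2
  simp only [exceptionalParam, hout]
  rw [← hk]
  have hSq : S.1 q.out.1 q.out.2 = c q - y ⬝ᵥ A (symUnit q.out.1 q.out.2) := by
    have hab : ∀ a b, S.1 a b = c s(a, b) - y ⬝ᵥ A (symUnit a b) := fun a b => rfl
    have h7 := hab q.out.1 q.out.2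
    rwa [hq] at h7
  simp only [M, of_apply, hSq]
  ring

theorem symNull_exceptionalCosts (A : SymMat n →ₗ[ℝ] (Fin k → ℝ)) :
    SymNull (exceptionalCosts A) := by
  have hsub : symOfEntries ⁻¹' exceptionalCosts A ⊆
      ⋃ (d : ℕ) (_ : 2 * k < d * (d + 1)) (j : ℕ) (σ : (Fin j ⊕ Fin d) ⊕ Unit ≃ Fin n),
        Set.range (exceptionalParam A σ) := by
    rintro c ⟨d, y, B, z, hd, hB, hBe, hS⟩
    obtain ⟨j, σ, h⟩ := mem_range_exceptionalParam A hd hB hBe hS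
    simp only [Set.mem_iUnion]
    exact ⟨d, hd, j, σ, h⟩
  refine measure_mono_null hsub ?_
  simp only [measure_iUnion_null_iff]
  exact fun d hd j σ => volume_range_exceptionalParam A σ hd

end Exceptional

/-! ### Global optimality -/

section Optimality

variable {n k r : ℕ} {α : ℝ} {A : SymMat n →ₗ[ℝ] (Fin k → ℝ)} {b : Fin k → ℝ}

theorem frob_nonneg_of_posSemidef {M N : Matrix (Fin n) (Fin n) ℝ} (hM : M.PosSemidef)
    (hN : N.PosSemidef) : 0 ≤ frob M N := by
  obtain ⟨V, l, h1, h2, h3⟩ := exists_orthogonal_diagonalization (posSemidef_iff_real.1 hM).1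
  have hMV : M = V * diagonal l * Vᵀ := by
    rw [← h3, Matrix.mul_assoc, h2, Matrix.mul_one]
  have hD : diagonal l = Vᵀ * M * V := by
    rw [Matrix.mul_assoc, h3, ← Matrix.mul_assoc, h1, Matrix.one_mul]
  have hl : ∀ i, 0 ≤ l i := by
    have : (diagonal l).PosSemidef := by
      rw [hD]
      simpa [conjTranspose_eq_transpose_of_trivial] using hM.conjTranspose_mul_mul_same V
    exact fun i => posSemidef_diagonal_iff.1 this i
  have hVN : (Vᵀ * N * V).PosSemidef := by
    simpa [conjTranspose_eq_transpose_of_trivial] using hN.conjTranspose_mul_mul_same V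
  have e : frob M N = (diagonal l * (Vᵀ * N * V)).trace := by
    rw [frob, (posSemidef_iff_real.1 hM).1, hMV]
    simp only [Matrix.mul_assoc]
    rw [trace_mul_comm]
    simp only [Matrix.mul_assoc]
  rw [e, trace]
  refine Finset.sum_nonneg fun i _ => ?_
  rw [diag_apply, diagonal_mul]
  exact mul_nonneg (hl i) hVN.diag_nonneg

theorem transpose_centering : (centering n)ᵀ = centering n := by
  simp [centering, transpose_vecMulVec]

theorem centering_mul {q : ℕ} {M : Matrix (Fin n) (Fin q) ℝ} (hM : Mᵀ *ᵥ ones n = 0) :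
    centering n * M = M := by
  have : vecMulVec (ones n) (ones n) * M = 0 := by
    rw [vecMulVec_mul, ← mulVec_transpose, hM]
    ext i j
    simp [vecMulVec_apply]
  rw [centering, Matrix.sub_mul, Matrix.smul_mul, this]; simp

theorem centering_mulVec_ones : centering n *ᵥ ones n = 0 := by
  rcases Nat.eq_zero_or_pos n with h | h
  · subst h
    exact Subsingleton.elim _ _
  · have h1 : ones n ⬝ᵥ ones n = n := by simp [ones, dotProduct]
    have h2 : (n : ℝ) ≠ 0 := by positivity
    rw [centering, sub_mulVec, one_mulVec, smul_mulVec, vecMulVec_mulVec, h1, op_smul_eq_smul,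
      smul_smul, inv_mul_cancel₀ h2, one_smul, sub_self]

theorem gramSym_mem_sdpFeasible (hα : 0 ≤ α) {R : Matrix (Fin n) (Fin r) ℝ}
    (hR : R ∈ lrFeasible r A b α) : gramSym R ∈ sdpFeasible A b α := by
  have h1 : (gramSym R : Matrix (Fin n) (Fin n) ℝ) *ᵥ ones n = 0 := by
    change (R * Rᵀ) *ᵥ ones n = 0
    rw [← mulVec_mulVec, hR.2.1, mulVec_zero]
  refine ⟨hR.1, h1, ?_, gramSym_mem_OmegaOne hα hR.2.2⟩
  rw [frob_vecMulVec, h1, dotProduct_zero]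

/-- Outside the exceptional set `R` cannot have full column rank: the complement of the top
right singular space would be mapped by `R` injectively into `e^⊥`, and `C - 𝒜*(y)` sends the image
into the span of `e`. -/
theorem exists_mulVec_eq_zero (hα : 0 < α) {C : SymMat n} (hC : C ∉ exceptionalCosts A)
    {R Θ : Matrix (Fin n) (Fin r) ℝ} {P : Matrix (Fin r) (Fin r) ℝ} {δ : ℝ}
    (hP : IsTopProjection α R P δ) {y : Fin k → ℝ} {z : Fin r → ℝ}
    (hkkt : IsKKT C A b α R y z Θ) {d : ℕ} {W : Matrix (Fin r) (Fin d) ℝ} (hPW : P * W = 0)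
    (hW : Wᵀ * W = 1) (hd : 2 * k < d * (d + 1)) : ∃ v ≠ 0, R *ᵥ v = 0 := by
  by_contra! hcon
  obtain ⟨Q, hQ, hΘ, hRQ⟩ := exists_eq_mul_of_mem_normalCone hα hkkt.1.2.2 hkkt.2.1
  have hQW : Q * W = 0 := by
    have : Q * P = Q := by
      rw [← (posSemidef_iff_real.1 hQ).1, ← hP.symm, ← transpose_mul, hP.mul_eq hRQ]
    rw [← this, Matrix.mul_assoc, hPW, Matrix.mul_zero]
  refine hC ⟨d, y, R * W, z ᵥ* W, hd, fun x hx => ?_, ?_, ?_⟩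
  · rw [← mulVec_mulVec] at hx
    have h1 : W *ᵥ x = 0 := by
      by_contra h
      exact hcon _ h hx
    rw [← one_mulVec x, ← hW, ← mulVec_mulVec, h1, mulVec_zero]
  · rw [transpose_mul, ← mulVec_mulVec, hkkt.1.2.1, mulVec_zero]
  · rw [← Matrix.mul_assoc, sub_eq_iff_eq_add.1 hkkt.2.2, Matrix.add_mul, Matrix.neg_mul, hΘ,
      Matrix.mul_assoc R, hQW, vecMulVec_mul]
    simp

/-- A multiplier at a rank deficient regular second order stationary point is a dual solution of
the semidefinite program. With `Θ = R Q`, the matrix `J(C - 𝒜*(y))J` splits into the positive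
semidefinite `J(C - 𝒜*(y))J + α⁻¹ R Q Rᵀ`, which annihilates `R`, and `-α⁻¹ R Q Rᵀ`, which acts on
the top left singular space only. -/
theorem neg_centered_mem_symNormalCone (hα : 0 < α) {C : SymMat n}
    {R Θ : Matrix (Fin n) (Fin r) ℝ} {P : Matrix (Fin r) (Fin r) ℝ} {δ : ℝ}
    (hP : IsTopProjection α R P δ) (hreg : IsRegularPoint A b α R)
    (hsos : IsSecondOrderStationary C A b α R) {y : Fin k → ℝ} {z : Fin r → ℝ}
    (hkkt : IsKKT C A b α R y z Θ) {v : Fin r → ℝ} (hv0 : v ≠ 0) (hv : R *ᵥ v = 0) :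
    -centered (C - opAdjoint A y) ∈ symNormalCone (OmegaOne n α) (gramSym R) := by
  obtain ⟨Q, hQ, hΘ, hRQ⟩ := exists_eq_mul_of_mem_normalCone hα hkkt.1.2.2 hkkt.2.1
  have hQs := (posSemidef_iff_real.1 hQ).1
  have hQR : Q * (Rᵀ * R) = α • Q := by
    have := congrArg transpose hRQ
    simpa [transpose_mul, hQs, Matrix.mul_assoc] using this
  have hJR : centering n * R = R := centering_mul hkkt.1.2.1
  set S : Matrix (Fin n) (Fin n) ℝ :=
    ((C - opAdjoint A y : SymMat n) : Matrix (Fin n) (Fin n) ℝ) with hS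
  set T : Matrix (Fin n) (Fin n) ℝ := centering n * S * centering n with hT
  have hTs : Tᵀ = T := (centered (C - opAdjoint A y)).2
  have hTR : T * R = -(R * Q) := by
    rw [hT, Matrix.mul_assoc, hJR, Matrix.mul_assoc, sub_eq_iff_eq_add.1 hkkt.2.2,
      Matrix.mul_add, mul_vecMulVec, centering_mulVec_ones, hΘ, Matrix.mul_neg,
      ← Matrix.mul_assoc, hJR]
    simp
  set D := R * Q * Rᵀ with hD
  have hDpsd : D.PosSemidef := by
    simpa [conjTranspose_eq_transpose_of_trivial] using hQ.mul_mul_conjTranspose_same R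
  have hDR : D * R = α • (R * Q) := by
    rw [hD, Matrix.mul_assoc, Matrix.mul_assoc, hQR, Matrix.mul_smul]
  set N := T + α⁻¹ • D with hN
  have hNR : N * R = 0 := by
    rw [hN, Matrix.add_mul, hTR, Matrix.smul_mul, hDR, smul_smul, inv_mul_cancel₀ hα.ne']
    simp
  have hNs : Nᵀ = N := by
    rw [hN, transpose_add, hTs, transpose_smul, (posSemidef_iff_real.1 hDpsd).1]
  have hNpsd : N.PosSemidef := by
    refine posSemidef_iff_real.2 ⟨hNs, fun u => ?_⟩
    -- remove from `u` its component in the top left singular space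
    set p := α⁻¹ • (P *ᵥ (Rᵀ *ᵥ u)) with hp
    set u' := u - R *ᵥ p with hu'
    have horth : ∀ x, (Rᵀ * R) *ᵥ x = α • x → u' ⬝ᵥ (R *ᵥ x) = 0 := by
      intro x hx
      have h1 : (P *ᵥ (Rᵀ *ᵥ u)) ⬝ᵥ x = u ⬝ᵥ (R *ᵥ x) := by
        have e1 := mulVec_dotProduct_mulVec P 1 (Rᵀ *ᵥ u) x
        have e2 := mulVec_dotProduct_mulVec Rᵀ 1 u x
        rw [one_mulVec, hP.symm, Matrix.mul_one, hP.mulVec_eq hx] at e1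
        rw [one_mulVec, transpose_transpose, Matrix.mul_one] at e2
        rw [e1, e2]
      rw [hu', sub_dotProduct, mulVec_dotProduct_mulVec, hx, hp, smul_dotProduct, dotProduct_smul,
        smul_smul, inv_mul_cancel₀ hα.ne', one_smul, h1, sub_self]
    have hNu : N *ᵥ u = N *ᵥ u' := by
      rw [hu', mulVec_sub, mulVec_mulVec, hNR]; simp
    have hquad : u ⬝ᵥ (N *ᵥ u) = u' ⬝ᵥ (N *ᵥ u') := by
      have h2 : (R *ᵥ p) ⬝ᵥ (N *ᵥ u') = 0 := by
        rw [mulVec_dotProduct_mulVec, ← hNs, ← transpose_mul, hNR]; simp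
      rw [hNu, hu', sub_dotProduct, ← hu', h2, sub_zero]
    rw [hquad, hN, add_mulVec, dotProduct_add, smul_mulVec, dotProduct_smul, smul_eq_mul]
    have hD0 := (posSemidef_iff_real.1 hDpsd).2 u'
    have hT0 : u' ⬝ᵥ (T *ᵥ u') = (centering n *ᵥ u') ⬝ᵥ (S *ᵥ (centering n *ᵥ u')) := by
      rw [mulVec_mulVec, mulVec_dotProduct_mulVec, transpose_centering, hT, Matrix.mul_assoc]
    have hS0 : 0 ≤ (centering n *ᵥ u') ⬝ᵥ (S *ᵥ (centering n *ᵥ u')) := by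
      refine quadForm_nonneg_of_isSecondOrderStationary hα hP hreg hsos hkkt hv0 hv ?_ ?_
      · have e1 := mulVec_dotProduct_mulVec (centering n) 1 u' (ones n)
        rwa [one_mulVec, transpose_centering, Matrix.mul_one, centering_mulVec_ones,
          dotProduct_zero] at e1
      · intro x hx
        rw [mulVec_dotProduct_mulVec, transpose_centering, hJR]
        exact horth x hx
    rw [hT0]
    have : 0 ≤ α⁻¹ * (u' ⬝ᵥ (D *ᵥ u')) := by positivity
    linarith
  intro Y hY
  have h1 := frob_nonneg_of_posSemidef hNpsd hY.1
  have h2 := frob_nonneg_of_posSemidef hDpsd hY.2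
  have hX : ((gramSym R : SymMat n) : Matrix (Fin n) (Fin n) ℝ) = R * Rᵀ := rfl
  have h3 : frob N (gramSym R : SymMat n) = 0 := by
    rw [hX, frob, hNs, ← Matrix.mul_assoc, hNR]; simp
  have h4 : frob D (gramSym R : SymMat n) = α * D.trace := by
    rw [hX, frob, (posSemidef_iff_real.1 hDpsd).1, ← Matrix.mul_assoc, hDR, Matrix.smul_mul,
      trace_smul, smul_eq_mul]
  have h5 : frob D (α • (1 : Matrix (Fin n) (Fin n) ℝ)) = α * D.trace := by
    rw [frob, (posSemidef_iff_real.1 hDpsd).1, Matrix.mul_smul, Matrix.mul_one, trace_smul,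
      smul_eq_mul]
  rw [frob_sub_right, h5] at h2
  have h6 : T = N - α⁻¹ • D := by rw [hN]; abel
  have h7 : ((-centered (C - opAdjoint A y) : SymMat n) : Matrix (Fin n) (Fin n) ℝ) = -T := rfl
  have h8 : ∀ Z, frob (-T) Z = α⁻¹ * frob D Z - frob N Z := by
    intro Z
    rw [h6]
    simp [frob, Matrix.sub_mul]
  rw [h7, h8, Submodule.coe_sub, frob_sub_right, frob_sub_right, h3, h4]
  have h9 : α⁻¹ * (frob D Y - α * D.trace) ≤ 0 :=
    mul_nonpos_of_nonneg_of_nonpos (by positivity) (by linarith)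
  linarith

/-- Weak duality: a multiplier `y` with `J(C - 𝒜*(y))J ∈ -𝒩(X)` certifies optimality of `X`. -/
theorem isSDPSolution_of_neg_centered_mem {C X : SymMat n} {y : Fin k → ℝ}
    (hX : X ∈ sdpFeasible A b α)
    (h : -centered (C - opAdjoint A y) ∈ symNormalCone (OmegaOne n α) X) :
    IsSDPSolution C A b α X := by
  refine ⟨hX, fun Y hY => ?_⟩
  have hJ : ∀ Z ∈ sdpFeasible A b α, centering n * (Z : Matrix (Fin n) (Fin n) ℝ) = Z := by
    intro Z hZ
    apply centering_mul
    have hs : (Z : Matrix (Fin n) (Fin n) ℝ)ᵀ = Z := Z.2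
    rw [hs, hZ.2.1]
  have hfrob : ∀ (S : SymMat n), ∀ Z ∈ sdpFeasible A b α,
      frob (centered S : Matrix (Fin n) (Fin n) ℝ) Z = frob (S : Matrix (Fin n) (Fin n) ℝ) Z := by
    intro S Z hZ
    have hs : (Z : Matrix (Fin n) (Fin n) ℝ)ᵀ = Z := Z.2
    have hS : (S : Matrix (Fin n) (Fin n) ℝ)ᵀ = S := S.2
    have hZJ : (Z : Matrix (Fin n) (Fin n) ℝ) * centering n = Z := by
      have := congrArg transpose (hJ Z hZ)
      rwa [transpose_mul, transpose_centering, hs] at this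
    have hcs : (centered S : Matrix (Fin n) (Fin n) ℝ)ᵀ = centered S := (centered S).2
    rw [frob, frob, hcs, hS]
    change (centering n * S * centering n * (Z : Matrix (Fin n) (Fin n) ℝ)).trace = _
    rw [Matrix.mul_assoc, hJ Z hZ, Matrix.mul_assoc, trace_mul_comm, Matrix.mul_assoc, hZJ]
  have h1 := h Y hY.2.2.2
  have h2 : frob ((-centered (C - opAdjoint A y) : SymMat n) : Matrix (Fin n) (Fin n) ℝ)
      (Y - X : SymMat n) = -(frob (C : Matrix (Fin n) (Fin n) ℝ) Y
        - frob (C : Matrix (Fin n) (Fin n) ℝ) X) := by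
    have e1 : ∀ Z ∈ sdpFeasible A b α,
        frob (centered (C - opAdjoint A y) : Matrix (Fin n) (Fin n) ℝ) Z
          = frob (C : Matrix (Fin n) (Fin n) ℝ) Z - y ⬝ᵥ b := by
      intro Z hZ
      rw [hfrob _ Z hZ, Submodule.coe_sub, frob_sub_left, frob_opAdjoint, hZ.1]
    rw [Submodule.coe_neg, Submodule.coe_sub, frob_sub_right]
    have e2 : ∀ (M Z : Matrix (Fin n) (Fin n) ℝ), frob (-M) Z = -frob M Z := by
      intro M Z; simp [frob]
    rw [e2, e2, e1 Y hY, e1 X hX]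
    ring
  rw [h2] at h1
  change frob (C : Matrix (Fin n) (Fin n) ℝ) X ≤ frob (C : Matrix (Fin n) (Fin n) ℝ) Y
  linarith

theorem isLRSolution_of_isSDPSolution (hα : 0 ≤ α) {C : SymMat n} {R : Matrix (Fin n) (Fin r) ℝ}
    (hR : R ∈ lrFeasible r A b α) (h : IsSDPSolution C A b α (gramSym R)) :
    IsLRSolution C A b α R := by
  refine ⟨hR, fun Q hQ => ?_⟩
  have : frob (C : Matrix (Fin n) (Fin n) ℝ) (gramSym R : SymMat n)
      ≤ frob (C : Matrix (Fin n) (Fin n) ℝ) (gramSym Q : SymMat n) :=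
    h.2 (gramSym_mem_sdpFeasible hα hQ)
  exact mul_le_mul_of_nonneg_left this (by norm_num)

/-- The top singular value has multiplicity at most `β / α`, which leaves enough room for the
dimension count behind `exceptionalCosts`. -/
theorem two_mul_lt_of_trace_le {m d : ℕ} (hm : 1 ≤ m) (hα : 0 < α) {β t : ℝ} (htβ : t ≤ β)
    (hd : ((r : ℝ) - d) * α ≤ t) (hr : (⌈β / α⌉ : ℝ) + √(2 * (m : ℝ)) ≤ (r : ℝ)) :
    2 * (m - 1) < d * (d + 1) := by
  have h1 : (r : ℝ) - d ≤ β / α := by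
    rw [le_div_iff₀ hα]; linarith
  have h2 : √(2 * (m : ℝ)) ≤ d := by
    have := Int.le_ceil (β / α)
    linarith
  have h3 : 2 * (m : ℝ) ≤ (d : ℝ) ^ 2 := (Real.sqrt_le_left (by positivity)).1 h2
  have h4 : 2 * m ≤ d ^ 2 := by exact_mod_cast h3
  have : d ^ 2 ≤ d * (d + 1) := by nlinarith
  omega

end Optimality

end

/-! ### The landscape theorem -/

theorem theorem2p6 (n r m : ℕ) (hm : 1 ≤ m) (α β : ℝ) (hα : 0 < α)
    (A : SymMat n →ₗ[ℝ] (Fin (m - 1) → ℝ)) (b : Fin (m - 1) → ℝ)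
    (hβ : IsGreatest {t : ℝ | ∃ X : SymMat n, A X = b ∧
      (X : Matrix (Fin n) (Fin n) ℝ) *ᵥ ones n = 0 ∧
      (X : Matrix (Fin n) (Fin n) ℝ).PosSemidef ∧
      t = (X : Matrix (Fin n) (Fin n) ℝ).trace} β)
    (hr : (⌈β / α⌉ : ℝ) + √(2 * (m : ℝ)) ≤ (r : ℝ)) :
    ∃ N : Set (SymMat n), SymNull N ∧
      ∀ C : SymMat n, C ∉ N → ∀ R : Matrix (Fin n) (Fin r) ℝ,
        IsRegularPoint A b α R → IsSecondOrderStationary C A b α R →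
          IsLRSolution C A b α R ∧
          IsSDPSolution C A b α (gramSym R) ∧
          IsUnit (gMap A R ∘ₗ gAdjoint A R :
            Module.End ℝ ((Fin (m - 1) → ℝ) × (Fin r → ℝ))) ∧
          (∃ y z Θ, IsKKT C A b α R y z Θ) ∧
          ∀ y z Θ, IsKKT C A b α R y z Θ →
            gAdjoint A R (y, z) = (C : Matrix (Fin n) (Fin n) ℝ) * R + Θ ∧
            (y, z) = Ring.inverse (gMap A R ∘ₗ gAdjoint A R :
              Module.End ℝ ((Fin (m - 1) → ℝ) × (Fin r → ℝ)))
                (gMap A R ((C : Matrix (Fin n) (Fin n) ℝ) * R + Θ)) ∧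
            -centered (C - opAdjoint A y) ∈ symNormalCone (OmegaOne n α) (gramSym R) := by
  refine ⟨exceptionalCosts A, symNull_exceptionalCosts A, fun C hC R hreg hsos => ?_⟩
  obtain ⟨P, d, W, δ, hP, hPW, hW, htr⟩ := exists_isTopProjection hα.le hreg.1.2.2
  have hX := gramSym_mem_sdpFeasible hα.le hreg.1
  have hβ' : (Rᵀ * R).trace ≤ β := by
    rw [trace_mul_comm]
    exact hβ.2 ⟨gramSym R, hX.1, hX.2.1, hX.2.2.2.1, rfl⟩
  have hd := two_mul_lt_of_trace_le hm hα hβ' htr hr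
  have hunit := isUnit_gMap_comp_gAdjoint hreg
  obtain ⟨y₀, z₀, Θ₀, hkkt₀⟩ := exists_isKKT hα hP hreg hsos.2.1
  obtain ⟨v, hv0, hv⟩ := exists_mulVec_eq_zero hα hC hP hkkt₀ hPW hW hd
  have hsdp := isSDPSolution_of_neg_centered_mem hX
    (neg_centered_mem_symNormalCone hα hP hreg hsos hkkt₀ hv0 hv)
  refine ⟨isLRSolution_of_isSDPSolution hα.le hreg.1 hsdp, hsdp, hunit, ⟨y₀, z₀, Θ₀, hkkt₀⟩, ?_⟩
  intro y z Θ hkkt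
  have hg := gAdjoint_eq_of_isKKT hkkt
  refine ⟨hg, ?_, neg_centered_mem_symNormalCone hα hP hreg hsos hkkt hv0 hv⟩
  rw [← hg]
  exact (LinearMap.congr_fun (Ring.inverse_mul_cancel _ hunit) (y, z)).symm
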